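/- Conventions. Rings are associative and unital. A groupoid $\mathcal G$ is a small category in which every morphism is invertible; it is identified with its set of morphisms, $\mathcal G_0$ is the set of its objects, identified with the identity morphisms, $d(g)$ and $r(g)$ are the domain and the range of $g$, and $gh$ is defined when $d(g)=r(h)$. A subgroupoid is a non-empty set of morphisms closed under (defined) products and inverses; it is wide if it contains all identities. Let $K$ be a commutative ring, $R$ a $K$-algebra with center $C(R)$, and $\mathcal G$ a finite groupoid. Let $\beta=(\{E_g\}_{g\in\mathcal G},\{\beta_g\}_{g\in\mathcal G})$ be a unital action of $\mathcal G$ on $R$: each $E_g=E_{r(g)}$ is a (two-sided) ideal of $R$ that has an identity element $1_g$, each $\beta_g:E_{g^{-1}}\to E_g$ is an isomorphism of $K$-algebras, $\beta_e=\mathrm{id}_{E_e}$ for $e\in\mathcal G_0$, and $\beta_g(\beta_h(x))=\beta_{gh}(x)$ whenever $d(g)=r(h)$ and $x\in E_{h^{-1}}$. Assume that $R=\bigoplus_{e\in\mathcal G_0}E_e$. For a wide subgroupoid $\mathcal H$ of $\mathcal G$ put $$R^{\beta_{\mathcal H}}=\{x\in R:\ \beta_h(x1_{h^{-1}})=x1_h\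 \text{for all } h\in\mathcal H\},\qquad R^\beta=R^{\beta_{\mathcal G}},\qquad C(R)^\beta=C(R)\cap R^\beta .$$ Let $R^{\beta_{\mathcal H}}C(R)$ be the $C(R)$-subalgebra of all finite sums of products $sc$ with $s\in R^{\beta_{\mathcal H}}$, $c\in C(R)$, and let $V_R(R^{\beta_{\mathcal H}})$ be the centralizer of $R^{\beta_{\mathcal H}}$ in $R$. For $g\in\mathcal G$ let $$J_g=\{y\in E_g:\ y\,\beta_g(x1_{g^{-1}})=xy\ \text{for all } x\in R\}.$$ For a subgroupoid $\mathcal H$ let $S_{\mathcal H}=\{h\in\mathcal H: J_h\neq\{0\}\}$ and let $\overline{\mathcal H}$ be the set of all subgroupoids $\mathcal L$ of $\mathcal G$ with $S_{\mathcal L}=S_{\mathcal H}$. Let $\mathcal A=\{\overline{\mathcal H}:\mathcal H \text{ a wide subgroupoid of } \mathcal G\}$. An algebra $A$ over a commutative ring $S$ is separable over $S$ if there is $z=\sum_i x_i\otimes y_i\in A\otimes_S A$ with $\sum_i x_iy_i=1$ and $\sum_i ax_i\otimes y_i=\sum_i x_i\otimes y_ia$ for all $a\in A$. Let $\mathcal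 B$ be the set of the $C(R)$-subalgebras of $R$ that are separable over $C(R)$. Theorem. Suppose that $R$ is a $\beta$-Galois extension of $R^\beta$, that is, there are $m$ and $x_1,\dots,x_m,y_1,\dots,y_m\in R$ such that $\sum_{i=1}^m x_i\beta_g(y_i1_{g^{-1}})$ equals $1_e$ if $g=e\in\mathcal G_0$ and equals $0$ if $g\notin\mathcal G_0$. Suppose also that $R^\beta$ is separable over $C(R)^\beta$. Then $$\overline\sigma:\mathcal A\to\mathcal B,\quad \overline{\mathcal H}\mapsto R^{\beta_{\mathcal H}}C(R),\qquad\text{and}\qquad \overline\gamma:\mathcal A\to\mathcal B,\quad \overline{\mathcal H}\mapsto V_R(R^{\beta_{\mathcal H}})\qquad(\mathcal H\ \text{wide}),$$ are well defined (they take values in $\mathcal B$ and do not depend on the wide subgroupoid $\mathcal H$ chosen in its class) and injective. -/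

import Mathlib

open CategoryTheory
open scoped TensorProduct

/-- An algebra `A` over a commutative ring `S` is *separable* if some `z = ∑ xᵢ ⊗ yᵢ` in `A ⊗[S] A`
satisfies `∑ xᵢ yᵢ = 1` and `r z = z r` for all `r : A`, where
`r (x ⊗ y) = (r x) ⊗ y` and `(x ⊗ y) r = x ⊗ (y r)`. -/
def IsSeparableAlgebra (S A : Type*) [CommRing S] [Ring A] [Algebra S A] : Prop :=
  ∃ z : A ⊗[S] A, LinearMap.mul' S A z = 1 ∧
    ∀ r : A, (r ⊗ₜ[S] (1 : A)) * z = z * ((1 : A) ⊗ₜ[S] r)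

/-- A unital action of a groupoid `G` on a `K`-algebra `R`.  An arrow `g : a ⟶ b` has domain `a` and
range `b`, and the product `g h` of the literature is `h ≫ g`.  Since `E_g` depends only on the
range of `g`, the ideals are indexed by the objects: `E_g = E b` and `E_{g⁻¹} = E a`. -/
structure UnitalGroupoidAction (K G R : Type*) [CommRing K] [Groupoid G] [Ring R]
    [Algebra K R] where
  /-- the ideals `E_e` -/
  E : G → NonUnitalSubalgebra K R
  mul_mem_left : ∀ (e : G) (r : R) {x : R}, x ∈ E e → r * x ∈ E e
  mul_mem_right : ∀ (e : G) (r : R) {x : R}, x ∈ E e → x * r ∈ E e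
  /-- the identity element `1_e` of `E_e` -/
  one : G → R
  one_mem : ∀ e, one e ∈ E e
  one_mul : ∀ (e : G) {x : R}, x ∈ E e → one e * x = x
  mul_one : ∀ (e : G) {x : R}, x ∈ E e → x * one e = x
  /-- the isomorphisms of `K`-algebras `β_g : E_{g⁻¹} → E_g` -/
  map : ∀ {a b : G}, (a ⟶ b) → (E a →ₙₐ[K] E b)
  bijective : ∀ {a b : G} (g : a ⟶ b), Function.Bijective (map g)
  map_id : ∀ (e : G) (x : E e), map (𝟙 e) x = x
  map_comp : ∀ {a b c : G} (h : a ⟶ b) (g : b ⟶ c) (x : E a), map g (map h x) = map (h ≫ g) x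

namespace UnitalGroupoidAction

variable {K G R : Type*} [CommRing K] [Groupoid G] [Ring R] [Algebra K R]
  (β : UnitalGroupoidAction K G R)

/-- `β_g(x 1_{g⁻¹})` as an element of `R`. -/
def act {a b : G} (g : a ⟶ b) (x : R) : R :=
  (β.map g ⟨x * β.one a, β.mul_mem_left a x (β.one_mem a)⟩ : β.E b)

theorem one_comm (e : G) (x : R) : β.one e * x = x * β.one e := by
  rw [← β.mul_one e (β.mul_mem_right e x (β.one_mem e)), mul_assoc,
    β.one_mul e (β.mul_mem_left e x (β.one_mem e))]

theorem act_add {a b : G} (g : a ⟶ b) (x y : R) : β.act g (x + y) = β.act g x + β.act g y := by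
  have h : (⟨(x + y) * β.one a, β.mul_mem_left a _ (β.one_mem a)⟩ : β.E a) =
      ⟨x * β.one a, β.mul_mem_left a _ (β.one_mem a)⟩ +
        ⟨y * β.one a, β.mul_mem_left a _ (β.one_mem a)⟩ := Subtype.ext (add_mul x y _)
  unfold act
  rw [h, map_add]
  rfl

theorem act_mul {a b : G} (g : a ⟶ b) (x y : R) : β.act g (x * y) = β.act g x * β.act g y := by
  have h : (⟨(x * y) * β.one a, β.mul_mem_left a _ (β.one_mem a)⟩ : β.E a) =
      ⟨x * β.one a, β.mul_mem_left a _ (β.one_mem a)⟩ *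
        ⟨y * β.one a, β.mul_mem_left a _ (β.one_mem a)⟩ := by
    apply Subtype.ext
    change (x * y) * β.one a = (x * β.one a) * (y * β.one a)
    rw [mul_assoc x (β.one a), ← mul_assoc (β.one a) y, β.one_comm a y, mul_assoc y,
      β.one_mul a (β.one_mem a), mul_assoc]
  unfold act
  rw [h, map_mul]
  rfl

theorem act_smul {a b : G} (g : a ⟶ b) (k : K) (x : R) : β.act g (k • x) = k • β.act g x := by
  have h : (⟨(k • x) * β.one a, β.mul_mem_left a _ (β.one_mem a)⟩ : β.E a) =
      k • ⟨x * β.one a, β.mul_mem_left a _ (β.one_mem a)⟩ :=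
    Subtype.ext (smul_mul_assoc k x _)
  unfold act
  rw [h, map_smul]
  rfl

theorem act_one {a b : G} (g : a ⟶ b) : β.act g 1 = β.one b := by
  obtain ⟨y, hy⟩ := (β.bijective g).2 ⟨β.one b, β.one_mem b⟩
  have h1 : β.map g ⟨1 * β.one a, β.mul_mem_left a 1 (β.one_mem a)⟩ * β.map g y = β.map g y := by
    rw [← map_mul]
    congr 1
    apply Subtype.ext
    change (1 * β.one a) * (y : R) = y
    rw [_root_.one_mul, β.one_mul a y.2]
  rw [hy] at h1
  have h2 := congrArg Subtype.val h1
  change β.act g 1 * β.one b = β.one b at h2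
  rwa [β.mul_one b (show β.act g 1 ∈ β.E b from Subtype.property _)] at h2

/-- The invariants `R^{β_H} = {r | β_h(r 1_{h⁻¹}) = r 1_h for all h ∈ H}` of the restriction of the
action to `H`; for `H = ⊤` these are the invariants `R^β`. -/
def invariants (H : Subgroupoid G) : Subalgebra K R where
  carrier := {r | ∀ (a b : G) (h : a ⟶ b), h ∈ H.arrows a b → β.act h r = r * β.one b}
  mul_mem' {r s} hr hs a b h hh := by
    rw [β.act_mul, hr a b h hh, hs a b h hh, mul_assoc r, ← mul_assoc (β.one b) s,
      β.one_comm b s, mul_assoc s, β.one_mul b (β.one_mem b), mul_assoc]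
  add_mem' {r s} hr hs a b h hh := by
    rw [β.act_add, hr a b h hh, hs a b h hh, add_mul]
  algebraMap_mem' k a b h hh := by
    rw [Algebra.algebraMap_eq_smul_one, β.act_smul, β.act_one, smul_mul_assoc, _root_.one_mul]

/-- `C(R)^β`, the invariants lying in the center of `R`. -/
def centerInvariants : Subring (Subring.center R) :=
  (β.invariants ⊤).toSubring.comap (Subring.center R).subtype

/-- `R^β` regarded as an algebra over `C(R)^β`. -/
def invariantsOverCenter : Subalgebra β.centerInvariants R where
  carrier := β.invariants ⊤
  mul_mem' hx hy := (β.invariants ⊤).mul_mem hx hy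
  add_mem' hx hy := (β.invariants ⊤).add_mem hx hy
  algebraMap_mem' c := c.2

/-- `R` is a `β`-Galois extension of `R^β`: there are `xᵢ, yᵢ ∈ R`, `1 ≤ i ≤ m`, such that
`∑ᵢ xᵢ β_g(yᵢ 1_{g⁻¹})` is `1_e` if `g` is the identity of the object `e`, and is `0` if `g` is not an
identity arrow.  (Finiteness of `G` is imposed separately.) -/
def IsGalois : Prop :=
  ∃ (m : ℕ) (x y : Fin m → R),
    (∀ e : G, ∑ i, x i * β.act (𝟙 e) (y i) = β.one e) ∧
    ∀ (a b : G) (g : a ⟶ b),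
      (∀ e : G, (⟨a, b, g⟩ : Σ a b : G, a ⟶ b) ≠ ⟨e, e, 𝟙 e⟩) →
        ∑ i, x i * β.act g (y i) = 0

/-- `J_g = {r ∈ E_g | r β_g(x 1_{g⁻¹}) = x r for all x ∈ R}`, a `C(R)`-submodule of `R`. -/
def J {a b : G} (g : a ⟶ b) : Submodule (Subring.center R) R where
  carrier := {r | r ∈ β.E b ∧ ∀ x : R, r * β.act g x = x * r}
  add_mem' {r s} hr hs := ⟨add_mem hr.1 hs.1, fun x => by rw [add_mul, mul_add, hr.2, hs.2]⟩
  zero_mem' := ⟨zero_mem _, fun x => by rw [zero_mul, mul_zero]⟩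
  smul_mem' c r hr := by
    refine ⟨β.mul_mem_left b (c : R) hr.1, fun x => ?_⟩
    change (c : R) * r * β.act g x = x * ((c : R) * r)
    rw [mul_assoc, hr.2, ← mul_assoc, ← mul_assoc, Subring.mem_center_iff.1 c.2 x]

/-- `S_H = {h ∈ H | J_h ≠ {0}}`, a set of arrows of `G`. -/
def S (H : Subgroupoid G) : Set (Σ a b : G, a ⟶ b) :=
  {p | p.2.2 ∈ H.arrows p.1 p.2.1 ∧ β.J p.2.2 ≠ ⊥}

/-- The class of `H`: all (non-empty) subgroupoids `L` of `G` with `S_L = S_H`. -/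
def cls (H : Subgroupoid G) : Set (Subgroupoid G) :=
  {L | L.objs.Nonempty ∧ β.S L = β.S H}

/-- The set of the classes of the wide subgroupoids of `G`. -/
def wideClasses : Set (Set (Subgroupoid G)) :=
  {c | ∃ H : Subgroupoid G, H.IsWide ∧ c = β.cls H}

/-- The class of a wide subgroupoid, as an element of the set of these classes. -/
def wideCls (H : Subgroupoid G) (hH : H.IsWide) : β.wideClasses :=
  ⟨β.cls H, H, hH, rfl⟩

/-- `R^{β_H} C(R)`: the set of finite sums of products `s c` with `s ∈ R^{β_H}` and `c ∈ C(R)`, as a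
`C(R)`-subalgebra of `R`. -/
def invariantsMulCenter (H : Subgroupoid G) : Subalgebra (Subring.center R) R :=
  (Submodule.span (Subring.center R) (β.invariants H : Set R)).toSubalgebra
    (Submodule.subset_span (β.invariants H).one_mem)
    (fun x y hx hy => by
      have h := Submodule.mul_mem_mul hx hy
      rw [Submodule.span_mul_span] at h
      refine Submodule.span_mono ?_ h
      rintro _ ⟨s, hs, t, ht, rfl⟩
      exact (β.invariants H).mul_mem hs ht)

/-- The centralizer `V_R(R^{β_H})`, as a `C(R)`-subalgebra of `R`. -/
def centralizerInvariants (H : Subgroupoid G) : Subalgebra (Subring.center R) R :=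
  Subalgebra.centralizer (Subring.center R) (β.invariants H : Set R)

end UnitalGroupoidAction

/-- The set of the separable `C(R)`-subalgebras of `R`. -/
def separableSubalgebras (R : Type*) [Ring R] : Set (Subalgebra (Subring.center R) R) :=
  {A | IsSeparableAlgebra (Subring.center R) A}

-- Expand an element v of V_R(R^{β_H}) in the Galois coordinates: it is the sum of its components Σ
-- xᵢ v β_h(yᵢ), h ∈ H, and each component lies in J_h. Since J_h = 0 unless h is a loop,
-- V_R(R^{β_H}) is the direct sum of the J_h with h ∈ S_H (`sum_comp`, `comp_J`). So it determines
-- S_H and is determined by it, which settles independence and injectivity for γ.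
--
-- Adjoining the center does not change a centralizer, so R^{β_H}C(R) determines V_R(R^{β_H}); this
-- gives injectivity of σ. Independence for σ needs the converse, the double centralizer property
-- `mem_invariantsMulCenter_iff`.
--
-- That property and both separability claims rest on certain central idempotents. The elements xᵢsⱼ
-- and tⱼyᵢ show that R is separable over its center, so R modulo a maximal ideal m of C(R) is
-- central simple. A Skolem–Noether argument shows that if a loop g at e acts trivially on C(R)
-- modulo m, with 1_e ≡ 1, then J_g J_{g⁻¹} is not contained in m (`exists_J_mul_J`). Globally there
-- is a central idempotent ε_g = Σ pᵢqᵢ with pᵢ ∈ J_g and qᵢ ∈ J_{g⁻¹}, such that ε_g is the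
-- identity on J_g and 1_e − ε_g lies in the ideal generated by the c − β_g(c)
-- (`exists_loopIdempotent`).
--
-- The index of H, the sum of ε_h over the loops h of H, is a unit of C(R) (`isUnit_index`): modulo
-- m it is the order of an inertia group, and if that order were 0 then all traces of central
-- elements would lie in m, against `span_tr_center`. Dividing by the index, the tensors Σ pᵢ ⊗ qᵢ
-- give a separability element of V_R(R^{β_H}); every d centralizing V_R(R^{β_H}) becomes a
-- C(R)-combination of traces; and the averaging r ↦ Σ pᵢ r qᵢ carries separability from R to
-- R^{β_H}C(R).

universe u

/-! ### Calculus of the action and of the modules J_g. -/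

namespace UnitalGroupoidAction

section Basic

variable {K G R : Type*} [CommRing K] [Groupoid G] [Ring R] [Algebra K R]
  (β : UnitalGroupoidAction K G R)

theorem act_mem {a b : G} (g : a ⟶ b) (x : R) : β.act g x ∈ β.E b := Subtype.property _

theorem one_central (e : G) : β.one e ∈ Subring.center R :=
  Subring.mem_center_iff.2 fun x => (β.one_comm e x).symm

theorem one_idem (e : G) : β.one e * β.one e = β.one e := β.one_mul e (β.one_mem e)

theorem act_mul_one {a b : G} (g : a ⟶ b) (x : R) : β.act g x * β.one b = β.act g x :=
  β.mul_one b (β.act_mem g x)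

theorem one_mul_act {a b : G} (g : a ⟶ b) (x : R) : β.one b * β.act g x = β.act g x :=
  β.one_mul b (β.act_mem g x)

/-- `x ↦ β_g(x 1_{g⁻¹})` as an additive map. -/
def actHom {a b : G} (g : a ⟶ b) : R →+ R := AddMonoidHom.mk' (β.act g) (β.act_add g)

theorem act_zero {a b : G} (g : a ⟶ b) : β.act g 0 = 0 := (β.actHom g).map_zero

theorem act_sub {a b : G} (g : a ⟶ b) (x y : R) : β.act g (x - y) = β.act g x - β.act g y :=
  (β.actHom g).map_sub x y

theorem act_sum {ι : Type*} (s : Finset ι) {a b : G} (g : a ⟶ b) (x : ι → R) :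
    β.act g (∑ i ∈ s, x i) = ∑ i ∈ s, β.act g (x i) :=
  map_sum (β.actHom g) x s

theorem act_of_mem {a b : G} (g : a ⟶ b) {x : R} (hx : x ∈ β.E a) :
    β.act g x = (β.map g ⟨x, hx⟩ : β.E b) := by
  unfold act
  congr 2
  exact Subtype.ext (β.mul_one a hx)

theorem act_id (e : G) (x : R) : β.act (𝟙 e) x = x * β.one e := by
  unfold act
  rw [β.map_id]

theorem act_act {a b c : G} (h : a ⟶ b) (g : b ⟶ c) (x : R) :
    β.act g (β.act h x) = β.act (h ≫ g) x := by
  rw [β.act_of_mem g (β.act_mem h x)]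
  unfold act
  rw [← β.map_comp]

theorem act_inv_act {a b : G} (g : a ⟶ b) (x : R) :
    β.act (Groupoid.inv g) (β.act g x) = x * β.one a := by
  rw [act_act, Groupoid.comp_inv, act_id]

theorem act_act_inv {a b : G} (g : a ⟶ b) (x : R) :
    β.act g (β.act (Groupoid.inv g) x) = x * β.one b := by
  rw [act_act, Groupoid.inv_comp, act_id]

theorem act_mul_one_source {a b : G} (g : a ⟶ b) (x : R) : β.act g (x * β.one a) = β.act g x := by
  rw [act_mul, ← β.act_one (𝟙 a), act_act, Category.id_comp, act_one, act_mul_one]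

/-- On E_b every element is a value of β_g, and products with c's image only see that component. -/
theorem act_center {a b : G} (g : a ⟶ b) {c : R} (hc : c ∈ Subring.center R) :
    β.act g c ∈ Subring.center R := by
  rw [Subring.mem_center_iff] at hc ⊢
  intro r
  have h1 : r * β.act g c = β.act g (β.act (Groupoid.inv g) r) * β.act g c := by
    rw [act_act_inv, mul_assoc, one_mul_act]
  have h2 : β.act g c * r = β.act g c * β.act g (β.act (Groupoid.inv g) r) := by
    rw [act_act_inv, ← β.one_comm, ← mul_assoc, act_mul_one]
  rw [h1, h2, ← act_mul, ← act_mul, hc]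

/-- The action of an arrow on the center of `R`. -/
def actCenter {a b : G} (g : a ⟶ b) (c : Subring.center R) : Subring.center R :=
  ⟨β.act g c, β.act_center g c.2⟩

theorem mem_invariants_top {r : R} :
    r ∈ β.invariants ⊤ ↔ ∀ (a b : G) (h : a ⟶ b), β.act h r = r * β.one b :=
  ⟨fun h a b g => h a b g trivial, fun h a b g _ => h a b g⟩

theorem J_mul_act {a b : G} {g : a ⟶ b} {y : R} (hy : y ∈ β.J g) (x : R) :
    y * β.act g x = x * y := hy.2 x

theorem J_mul_one {a b : G} {g : a ⟶ b} {y : R} (hy : y ∈ β.J g) : y * β.one b = y :=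
  β.mul_one b hy.1

theorem J_comp {a b c : G} {g : a ⟶ b} {h : b ⟶ c} {y z : R} (hy : y ∈ β.J g)
    (hz : z ∈ β.J h) : y * z ∈ β.J (g ≫ h) := by
  refine ⟨β.mul_mem_left c y hz.1, fun x => ?_⟩
  rw [← act_act, mul_assoc, hz.2, ← mul_assoc, hy.2, mul_assoc]

theorem J_inv {a b : G} {g : a ⟶ b} {y : R} (hy : y ∈ β.J (Groupoid.inv g)) (x : R) :
    β.act g x * y = y * x := by
  rw [← β.J_mul_act hy, act_inv_act, ← β.one_comm, ← mul_assoc, β.J_mul_one hy]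

theorem J_id_center {e : G} {y : R} (hy : y ∈ β.J (𝟙 e)) : y ∈ Subring.center R := by
  rw [Subring.mem_center_iff]
  intro r
  rw [← β.J_mul_act hy, act_id, ← β.one_comm, ← mul_assoc, β.J_mul_one hy]

theorem center_mul_J {a b : G} {g : a ⟶ b} {c y : R} (hc : c ∈ Subring.center R)
    (hy : y ∈ β.J g) : c * y ∈ β.J g :=
  (β.J g).smul_mem ⟨c, hc⟩ hy

theorem act_J {a b : G} {f : a ⟶ a} {y : R} (g : a ⟶ b) (hy : y ∈ β.J f) :
    β.act g y ∈ β.J (Groupoid.inv g ≫ f ≫ g) := by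
  refine ⟨β.act_mem g y, fun x => ?_⟩
  rw [← act_act, ← act_act, ← act_mul, hy.2, act_mul, act_act_inv, mul_assoc, one_mul_act]

/-- For an invariant s the factor β_g(s) is s 1_b, so the defining relation of J_g turns into
commutation with s. -/
theorem J_mem_centralizer {H : Subgroupoid G} {a b : G} {g : a ⟶ b} (hg : g ∈ H.arrows a b)
    {y : R} (hy : y ∈ β.J g) : y ∈ β.centralizerInvariants H := by
  intro s hs
  rw [← β.J_mul_act hy, hs a b g hg, ← β.one_comm, ← mul_assoc, β.J_mul_one hy]

end Basic

/-! ### Galois coordinates and separability families. -/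

/-- `u` and `v` form a separability element `∑ uⱼ ⊗ vⱼ` for `S`, balanced over `Z`, tested on
biadditive maps. -/
def IsSepFamily {R : Type u} [Ring R] (Z S : Set R) {ι : Type*} [Fintype ι] (u v : ι → R) : Prop :=
  ∑ j, u j * v j = 1 ∧ ∀ (M : Type u) [AddCommGroup M] (F : R → R → M),
    (∀ r r' s, F (r + r') s = F r s + F r' s) → (∀ r s s', F r (s + s') = F r s + F r s') →
    (∀ z ∈ Z, ∀ r s, F (r * z) s = F r (z * s)) →
    ∀ x ∈ S, ∑ j, F (x * u j) (v j) = ∑ j, F (u j) (v j * x)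

/-- Galois coordinates and a separability family of `R^β` over `C(R)^β`, for an action on
`R = ⨁ E_e`. -/
structure GaloisCoordinates {K G : Type*} {R : Type u} [CommRing K] [Groupoid G] [Fintype G] [Ring R]
    [Algebra K R] (β : UnitalGroupoidAction K G R) where
  orth : ∀ e f : G, e ≠ f → β.one e * β.one f = 0
  sum_one : ∑ e, β.one e = 1
  {m : ℕ}
  x : Fin m → R
  y : Fin m → R
  coord_id : ∀ e : G, ∑ i, x i * β.act (𝟙 e) (y i) = β.one e
  coord_loop : ∀ (e : G) (g : e ⟶ e), g ≠ 𝟙 e → ∑ i, x i * β.act g (y i) = 0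
  coord_ne : ∀ (a b : G) (g : a ⟶ b), a ≠ b → ∑ i, x i * β.act g (y i) = 0
  {n : ℕ}
  s : Fin n → R
  t : Fin n → R
  s_mem : ∀ j, s j ∈ β.invariants ⊤
  t_mem : ∀ j, t j ∈ β.invariants ⊤
  sep : IsSepFamily {z | z ∈ Subring.center R ∧ z ∈ β.invariants ⊤} (β.invariants ⊤ : Set R) s t

theorem exists_galoisCoordinates {K G : Type*} {R : Type u} [CommRing K] [Groupoid G] [Fintype G]
    [DecidableEq G] [Ring R] [Algebra K R]
    (β : UnitalGroupoidAction K G R)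
    (hE : DirectSum.IsInternal fun e : G => (β.E e).toSubmodule)
    (hGalois : β.IsGalois)
    (hsep : IsSeparableAlgebra β.centerInvariants β.invariantsOverCenter) :
    Nonempty β.GaloisCoordinates := by
  have orth : ∀ e f : G, e ≠ f → β.one e * β.one f = 0 := by
    intro e f hef
    have hd := hE.submodule_iSupIndep.pairwiseDisjoint hef
    rw [Function.onFun, Submodule.disjoint_def] at hd
    exact hd _ (β.mul_mem_right e _ (β.one_mem e)) (β.mul_mem_left f _ (β.one_mem f))
  have sum_one : ∑ e, β.one e = 1 := by
    have htop := hE.submodule_iSup_eq_top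
    have h1 : (1 : R) ∈ ⨆ e : G, (β.E e).toSubmodule := by rw [htop]; trivial
    rw [Submodule.mem_iSup_iff_exists_finsupp] at h1
    obtain ⟨z, hz, hz1⟩ := h1
    rw [Finsupp.sum_fintype _ _ (fun _ => rfl)] at hz1
    -- The orthogonality of the 1_e forces the component of 1 in E_e to be 1_e.
    have key : ∀ e, β.one e = z e := by
      intro e
      calc β.one e = β.one e * ∑ f, z f := by rw [hz1, _root_.mul_one]
        _ = ∑ f, β.one e * z f := Finset.mul_sum _ _ _
        _ = β.one e * z e := by
          refine Finset.sum_eq_single e (fun f _ hf => ?_) (fun h => absurd (Finset.mem_univ e) h)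
          rw [← β.one_mul f (hz f), ← mul_assoc, orth e f hf.symm, zero_mul]
        _ = z e := β.one_mul e (hz e)
    rw [← hz1]
    exact Finset.sum_congr rfl fun e _ => key e
  obtain ⟨m, x, y, h1, h2⟩ := hGalois
  obtain ⟨w, hw1, hw⟩ := hsep
  obtain ⟨n, s, t, rfl⟩ := TensorProduct.exists_sum_tmul_eq w
  refine ⟨⟨orth, sum_one, x, y, h1, ?_, ?_, fun j => s j, fun j => t j, fun j => (s j).2,
    fun j => (t j).2, ?_, ?_⟩⟩
  · rintro e g hg
    refine h2 e e g fun f hf => hg ?_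
    cases hf
    rfl
  · rintro a b g hab
    refine h2 a b g fun f hf => hab ?_
    cases hf
    rfl
  · have h := congrArg Subtype.val hw1
    simp only [map_sum, LinearMap.mul'_apply] at h
    rw [AddSubmonoidClass.coe_finsetSum] at h
    exact h
  · intro M _ F hl hr hb r hrS
    let Fh : β.invariantsOverCenter →+ β.invariantsOverCenter →+ M :=
      AddMonoidHom.mk' (fun p => AddMonoidHom.mk' (fun q => F p q) fun q q' => hr _ _ _)
        fun p p' => by ext q; exact hl _ _ _
    have h := congrArg (TensorProduct.liftAddHom Fh (fun z p q => by
      change F ((z : R) * p) q = F p ((z : R) * q)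
      rw [← Subring.mem_center_iff.1 z.1.2 (p : R)]
      exact hb _ ⟨z.1.2, z.2⟩ _ _)) (hw ⟨r, hrS⟩)
    simp only [Finset.mul_sum, Finset.sum_mul, Algebra.TensorProduct.tmul_mul_tmul, _root_.one_mul,
      _root_.mul_one, map_sum, TensorProduct.liftAddHom_tmul] at h
    exact h

end UnitalGroupoidAction

/-! ### Traces, and the decomposition of the centralizer into the J_g. -/

namespace UnitalGroupoidAction

section Trace

variable {K G R : Type*} [CommRing K] [Groupoid G] [Fintype G] [∀ a b : G, Fintype (a ⟶ b)]
  [Ring R] [Algebra K R] (β : UnitalGroupoidAction K G R)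

open Classical in
/-- The trace `r ↦ ∑_{h ∈ H} β_h(r 1_{h⁻¹})`. -/
noncomputable def tr (H : Subgroupoid G) (r : R) : R :=
  ∑ b : G, ∑ a : G, ∑ f : a ⟶ b, if f ∈ H.arrows a b then β.act f r else 0

theorem tr_mul {H : Subgroupoid G} {s : R} (hs : s ∈ β.invariants H) (r : R) :
    β.tr H (r * s) = β.tr H r * s := by
  simp only [tr, Finset.sum_mul]
  refine Finset.sum_congr rfl fun b _ => Finset.sum_congr rfl fun a _ =>
    Finset.sum_congr rfl fun f _ => ?_
  split_ifs with h
  · rw [act_mul, hs a b f h, ← β.one_comm, ← mul_assoc, act_mul_one]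
  · simp

theorem tr_center (H : Subgroupoid G) {c : R} (hc : c ∈ Subring.center R) :
    β.tr H c ∈ Subring.center R := by
  refine sum_mem fun b _ => sum_mem fun a _ => sum_mem fun f _ => ?_
  split_ifs
  · exact β.act_center f hc
  · exact zero_mem _

end Trace

namespace GaloisCoordinates

variable {K G : Type*} {R : Type u} [CommRing K] [Groupoid G] [Fintype G]
  [Ring R] [Algebra K R] {β : UnitalGroupoidAction K G R} (D : β.GaloisCoordinates)

include D in
theorem mul_one_ne {e f : G} (h : e ≠ f) {x : R} (hx : x ∈ β.E e) : x * β.one f = 0 := by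
  rw [← β.mul_one e hx, mul_assoc, D.orth e f h, mul_zero]

include D in
theorem mul_ne {e f : G} (h : e ≠ f) {x y : R} (hx : x ∈ β.E e) (hy : y ∈ β.E f) : x * y = 0 := by
  rw [← β.one_mul f hy, ← mul_assoc, D.mul_one_ne h hx, zero_mul]

include D in
theorem act_ne {a b c : G} (h : c ≠ a) (g : a ⟶ b) {x : R} (hx : x ∈ β.E c) : β.act g x = 0 := by
  rw [← act_mul_one_source, D.mul_one_ne h hx, act_zero]

include D in
-- Test the relation at x = 1_b: β_g only sees the E_a-component of 1_b, which is 0. Hence only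
-- loops matter.
theorem J_ne {a b : G} (h : a ≠ b) {g : a ⟶ b} {y : R} (hy : y ∈ β.J g) : y = 0 := by
  have h1 := hy.2 (β.one b)
  rw [D.act_ne h.symm g (β.one_mem b), mul_zero, β.one_mul b hy.1] at h1
  exact h1.symm

/-- This is β_g applied to the coordinate relation of g⁻¹. -/
theorem coord_inv_loop {e : G} (g : e ⟶ e) [Decidable (g = 𝟙 e)] :
    ∑ i, β.act g (D.x i) * D.y i = if g = 𝟙 e then β.one e else 0 := by
  have h : ∑ i, β.act g (D.x i) * D.y i =
      β.act g (∑ i, D.x i * β.act (Groupoid.inv g) (D.y i)) := by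
    rw [act_sum]
    refine Finset.sum_congr rfl fun i _ => ?_
    rw [act_mul, act_act_inv, ← β.one_comm, ← mul_assoc, act_mul_one]
  rw [h]
  split_ifs with hg
  · subst hg
    rw [show Groupoid.inv (𝟙 e) = 𝟙 e by simp, D.coord_id, act_id, one_idem]
  · rw [D.coord_loop, act_zero]
    intro h1
    apply hg
    rw [← Category.comp_id g]
    conv_lhs => rw [← h1]
    exact Groupoid.comp_inv g

theorem coord_inv_ne {a b : G} (h : a ≠ b) (g : a ⟶ b) :
    ∑ i, β.act g (D.x i) * D.y i = 0 := by
  have h : ∑ i, β.act g (D.x i) * D.y i =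
      β.act g (∑ i, D.x i * β.act (Groupoid.inv g) (D.y i)) := by
    rw [act_sum]
    refine Finset.sum_congr rfl fun i _ => ?_
    rw [act_mul, act_act_inv, ← β.one_comm, ← mul_assoc, act_mul_one]
  rw [h, D.coord_ne b a _ (Ne.symm ‹_›), act_zero]

theorem coord_loop_ite {e : G} (g : e ⟶ e) [Decidable (g = 𝟙 e)] :
    ∑ i, D.x i * β.act g (D.y i) = if g = 𝟙 e then β.one e else 0 := by
  split_ifs with hg
  · rw [hg, D.coord_id]
  · exact D.coord_loop e g hg

include D in
theorem mul_sum_one (r : R) : ∑ e, r * β.one e = r := by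
  rw [← Finset.mul_sum, D.sum_one, _root_.mul_one]

theorem sum_x_mul_y : ∑ i, D.x i * D.y i = 1 := by
  have h : ∀ i, D.x i * D.y i = ∑ e, D.x i * β.act (𝟙 e) (D.y i) := fun i => by
    simp only [act_id]
    rw [← Finset.mul_sum, D.mul_sum_one]
  simp only [h]
  rw [Finset.sum_comm, ← D.sum_one]
  exact Finset.sum_congr rfl fun e _ => D.coord_id e

variable [∀ a b : G, Fintype (a ⟶ b)]

include D in
theorem tr_mem_invariants (H : Subgroupoid G) (r : R) : β.tr H r ∈ β.invariants H := by
  classical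
  intro a' b' h hh
  have hL : β.act h (β.tr H r) =
      ∑ a : G, ∑ f : a ⟶ a', if f ∈ H.arrows a a' then β.act (f ≫ h) r else 0 := by
    unfold tr
    rw [act_sum]
    refine (Finset.sum_eq_single a' (fun c _ hc => ?_)
      (fun h => absurd (Finset.mem_univ _) h)).trans ?_
    · apply D.act_ne hc
      refine sum_mem fun a _ => sum_mem fun f _ => ?_
      split_ifs
      · exact β.act_mem _ _
      · exact zero_mem _
    · rw [act_sum]
      refine Finset.sum_congr rfl fun a _ => ?_
      rw [act_sum]
      refine Finset.sum_congr rfl fun f _ => ?_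
      split_ifs
      · exact β.act_act f h r
      · exact β.act_zero h
  have hR : β.tr H r * β.one b' =
      ∑ a : G, ∑ f : a ⟶ b', if f ∈ H.arrows a b' then β.act f r else 0 := by
    unfold tr
    rw [Finset.sum_mul]
    have hmem : ∀ c : G, (∑ a : G, ∑ f : a ⟶ c, if f ∈ H.arrows a c then β.act f r else 0) ∈
        β.E c := fun c => by
      refine sum_mem fun a _ => sum_mem fun f _ => ?_
      split_ifs
      · exact β.act_mem _ _
      · exact zero_mem _
    refine (Finset.sum_eq_single b' (fun c _ hc => ?_)
      (fun h => absurd (Finset.mem_univ _) h)).trans ?_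
    · exact D.mul_one_ne hc (hmem c)
    · exact β.mul_one b' (hmem b')
  rw [hL, hR]
  refine Finset.sum_congr rfl fun a _ => ?_
  -- Composition with h is a bijection between the arrows of H into a' and those into b'.
  refine Fintype.sum_equiv ⟨fun f => f ≫ h, fun f => f ≫ Groupoid.inv h, fun f => by simp,
    fun f => by simp⟩ _ _ fun f => ?_
  have hiff : f ≫ h ∈ H.arrows a b' ↔ f ∈ H.arrows a a' := by
    refine ⟨fun h1 => ?_, fun h1 => H.mul h1 hh⟩
    have := H.mul h1 (H.inv hh)
    simpa using this
  simp only [Equiv.coe_fn_mk, hiff]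

/-- The coordinates kill every arrow of the trace except the identities, all of which are in H by
wideness. With `sum_tr_y`, this gives dual bases of R over R^{β_H}. -/
theorem sum_x_tr {H : Subgroupoid G} (hH : H.IsWide) (r : R) :
    ∑ i, D.x i * β.tr H (D.y i * r) = r := by
  classical
  simp only [tr, Finset.mul_sum]
  rw [Finset.sum_comm]
  conv_rhs => rw [← D.mul_sum_one r]
  refine Finset.sum_congr rfl fun b _ => ?_
  rw [Finset.sum_comm]
  have key : ∀ (a : G) (f : a ⟶ b),
      ∑ i, D.x i * (if f ∈ H.arrows a b then β.act f (D.y i * r) else 0) =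
      if f ∈ H.arrows a b then (∑ i, D.x i * β.act f (D.y i)) * β.act f r else 0 := by
    intro a f
    split_ifs
    · rw [Finset.sum_mul]
      exact Finset.sum_congr rfl fun i _ => by rw [act_mul, mul_assoc]
    · simp
  refine (Finset.sum_eq_single b (fun a _ hab => ?_)
      (fun h => absurd (Finset.mem_univ _) h)).trans ?_
  · rw [Finset.sum_comm]
    refine Finset.sum_eq_zero fun f _ => ?_
    rw [key, D.coord_ne a b f hab]
    simp
  · rw [Finset.sum_comm]
    simp only [key, D.coord_loop_ite]
    refine (Finset.sum_eq_single (𝟙 b) (fun f _ hf => ?_)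
      (fun h => absurd (Finset.mem_univ _) h)).trans ?_
    · simp [hf]
    · rw [if_pos (hH.wide b), if_pos rfl, act_id, ← β.one_comm, ← mul_assoc, one_idem]

theorem sum_tr_y {H : Subgroupoid G} (hH : H.IsWide) (r : R) :
    ∑ i, β.tr H (r * D.x i) * D.y i = r := by
  classical
  simp only [tr, Finset.sum_mul]
  rw [Finset.sum_comm]
  conv_rhs => rw [← D.mul_sum_one r]
  refine Finset.sum_congr rfl fun b _ => ?_
  rw [Finset.sum_comm]
  have key : ∀ (a : G) (f : a ⟶ b),
      ∑ i, (if f ∈ H.arrows a b then β.act f (r * D.x i) else 0) * D.y i =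
      if f ∈ H.arrows a b then β.act f r * ∑ i, β.act f (D.x i) * D.y i else 0 := by
    intro a f
    split_ifs
    · rw [Finset.mul_sum]
      exact Finset.sum_congr rfl fun i _ => by rw [act_mul, mul_assoc]
    · simp
  refine (Finset.sum_eq_single b (fun a _ hab => ?_)
      (fun h => absurd (Finset.mem_univ _) h)).trans ?_
  · rw [Finset.sum_comm]
    refine Finset.sum_eq_zero fun f _ => ?_
    rw [key, D.coord_inv_ne hab f]
    simp
  · rw [Finset.sum_comm]
    simp only [key, D.coord_inv_loop]
    refine (Finset.sum_eq_single (𝟙 b) (fun f _ hf => ?_)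
      (fun h => absurd (Finset.mem_univ _) h)).trans ?_
    · simp [hf]
    · rw [if_pos (hH.wide b), if_pos rfl, act_id, mul_assoc, one_idem]

/-- The projection `v ↦ ∑ xᵢ v β_g(yᵢ)` of the centralizer of the invariants onto `J_g`. -/
noncomputable def comp {a b : G} (g : a ⟶ b) (v : R) : R := ∑ i, D.x i * v * β.act g (D.y i)

/-- Expand yᵢ x in the dual bases: the traces that occur are fixed by g and commute with v, so they
can be moved to the left of v, where they reassemble x xₖ. -/
theorem comp_mem_J {H : Subgroupoid G} (hH : H.IsWide) {a b : G} {g : a ⟶ b}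
    (hg : g ∈ H.arrows a b) {v : R} (hv : v ∈ β.centralizerInvariants H) :
    D.comp g v ∈ β.J g := by
  refine ⟨sum_mem fun i _ => β.mul_mem_left b _ (β.act_mem g _), fun x => ?_⟩
  have hL : D.comp g v * β.act g x = ∑ i, D.x i * v * β.act g (D.y i * x) := by
    rw [comp, Finset.sum_mul]
    exact Finset.sum_congr rfl fun i _ => by rw [act_mul, mul_assoc]
  have h1 : ∀ i, β.act g (D.y i * x) =
      ∑ k, β.tr H (D.y i * x * D.x k) * β.act g (D.y k) := fun i => by
    conv_lhs => rw [← D.sum_tr_y hH (D.y i * x)]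
    rw [act_sum]
    refine Finset.sum_congr rfl fun k _ => ?_
    rw [act_mul, D.tr_mem_invariants H _ a b g hg, mul_assoc, one_mul_act]
  have h2 : ∀ k, x * D.x k = ∑ i, D.x i * β.tr H (D.y i * x * D.x k) := fun k => by
    simp only [mul_assoc]
    exact (D.sum_x_tr hH _).symm
  rw [hL, comp, Finset.mul_sum]
  simp only [h1, Finset.mul_sum]
  rw [Finset.sum_comm]
  refine Finset.sum_congr rfl fun k _ => ?_
  rw [← mul_assoc, ← mul_assoc, h2, Finset.sum_mul, Finset.sum_mul]
  refine Finset.sum_congr rfl fun i _ => ?_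
  have h3 := hv _ (D.tr_mem_invariants H (D.y i * x * D.x k))
  simp only [mul_assoc] at h3 ⊢
  rw [← mul_assoc v, ← h3]
  simp only [mul_assoc]

omit [∀ a b : G, Fintype (a ⟶ b)] in
-- Moving y to the left through the relation of J_g leaves β_g of the coordinate sum of f ≫ g⁻¹,
-- which vanishes unless f = g.
theorem comp_J {e : G} {g f : e ⟶ e} [Decidable (f = g)] {y : R} (hy : y ∈ β.J g) :
    D.comp f y = if f = g then y else 0 := by
  classical
  have h : D.comp f y = y * β.act g (∑ i, D.x i * β.act (f ≫ Groupoid.inv g) (D.y i)) := by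
    rw [act_sum, comp, Finset.mul_sum]
    refine Finset.sum_congr rfl fun i _ => ?_
    rw [act_mul, act_act, Category.assoc, Groupoid.inv_comp, Category.comp_id, ← mul_assoc, hy.2]
  have hiff : f ≫ Groupoid.inv g = 𝟙 e ↔ f = g := by
    refine ⟨fun h1 => ?_, fun h1 => by rw [h1, Groupoid.comp_inv]⟩
    have := congrArg (· ≫ g) h1
    simpa using this
  rw [h, D.coord_loop_ite]
  simp only [hiff]
  split_ifs
  · exact (hy.2 _).trans (β.one_mul e hy.1)
  · rw [act_zero, mul_zero]

omit [∀ a b : G, Fintype (a ⟶ b)] in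
theorem comp_of_mem_ne {a b c : G} (h : c ≠ b) (f : a ⟶ b) {y : R} (hy : y ∈ β.E c) :
    D.comp f y = 0 := by
  refine Finset.sum_eq_zero fun i _ => ?_
  exact D.mul_ne h (β.mul_mem_left c _ hy) (β.act_mem f _)

open Classical in
-- In v = Σ xᵢ tr(yᵢ) v let v pass the traces, then split each trace into arrows. The components at
-- non-loops vanish by `J_ne`.
theorem sum_comp {H : Subgroupoid G} (hH : H.IsWide) {v : R}
    (hv : v ∈ β.centralizerInvariants H) :
    v = ∑ e : G, ∑ f : e ⟶ e, if f ∈ H.arrows e e then D.comp f v else 0 := by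
  have h : v = ∑ b : G, ∑ a : G, ∑ f : a ⟶ b, if f ∈ H.arrows a b then D.comp f v else 0 := by
    have h1 : v = ∑ i, D.x i * v * β.tr H (D.y i) := by
      have h2 := D.sum_x_tr hH 1
      have h3 : ∀ i, D.x i * v * β.tr H (D.y i) = D.x i * β.tr H (D.y i * 1) * v := fun i => by
        rw [_root_.mul_one, mul_assoc, mul_assoc]
        congr 1
        exact (hv _ (D.tr_mem_invariants H _)).symm
      simp only [h3]
      rw [← Finset.sum_mul, h2, _root_.one_mul]
    conv_lhs => rw [h1]
    simp only [tr, Finset.mul_sum]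
    rw [Finset.sum_comm]
    refine Finset.sum_congr rfl fun b _ => ?_
    rw [Finset.sum_comm]
    refine Finset.sum_congr rfl fun a _ => ?_
    rw [Finset.sum_comm]
    refine Finset.sum_congr rfl fun f _ => ?_
    split_ifs
    · rfl
    · simp
  conv_lhs => rw [h]
  refine Finset.sum_congr rfl fun b _ => ?_
  refine Finset.sum_eq_single b (fun a _ hab => Finset.sum_eq_zero fun f _ => ?_)
      (fun h => absurd (Finset.mem_univ _) h)
  split_ifs with hf
  · exact D.J_ne hab (D.comp_mem_J hH hf hv)
  · rfl

include D in
theorem centralizerInvariants_le {H L : Subgroupoid G} (hH : H.IsWide) (h : β.S H = β.S L) :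
    β.centralizerInvariants H ≤ β.centralizerInvariants L := by
  classical
  intro v hv
  rw [D.sum_comp hH hv]
  refine sum_mem fun e _ => sum_mem fun f _ => ?_
  split_ifs with hf
  · have hJ := D.comp_mem_J hH hf hv
    by_cases h0 : β.J f = ⊥
    · rw [h0, Submodule.mem_bot] at hJ
      rw [hJ]
      exact zero_mem _
    · have hS : (⟨e, e, f⟩ : Σ a b : G, a ⟶ b) ∈ β.S L := h ▸ ⟨hf, h0⟩
      exact β.J_mem_centralizer hS.1 hJ
  · exact zero_mem _

include D in
-- If J_g ≠ 0 with g outside L, a non-zero y ∈ J_g would lie in the centralizer for L while all its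
-- components at the loops of L vanish.
theorem S_subset {H L : Subgroupoid G} (hL : L.IsWide)
    (h : β.centralizerInvariants H ≤ β.centralizerInvariants L) : β.S H ⊆ β.S L := by
  classical
  rintro ⟨a, b, g⟩ ⟨hg, hJ⟩
  refine ⟨?_, hJ⟩
  obtain ⟨y, hy, hy0⟩ := (Submodule.ne_bot_iff _).1 hJ
  by_contra hgL
  change g ∉ L.arrows a b at hgL
  by_cases hab : a = b
  · subst hab
    apply hy0
    rw [D.sum_comp hL (h (β.J_mem_centralizer hg hy))]
    refine Finset.sum_eq_zero fun e _ => Finset.sum_eq_zero fun f _ => ?_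
    split_ifs with hf
    · by_cases hea : a = e
      · subst hea
        rw [D.comp_J hy, if_neg]
        rintro rfl
        exact hgL hf
      · exact D.comp_of_mem_ne hea f hy.1
    · rfl
  · exact hy0 (D.J_ne hab hy)

end GaloisCoordinates

end UnitalGroupoidAction

/-! ### Central separable algebras over a field. -/

section CentralSeparableOverField

variable {k A ι : Type*} [Field k] [Ring A] [Algebra k A] [Fintype ι]

/-- Averaging a linear projection onto an ideal I on both sides with the separability element gives
a central e ∈ I that acts as the identity on I. Being a scalar, e is 0 or invertible. -/
theorem isSimpleRing_of_separable_of_central [Nontrivial A] (u v : ι → A)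
    (huv : ∑ j, u j * v j = 1)
    (hbal : ∀ (F : A →ₗ[k] A →ₗ[k] A) (x : A), ∑ j, F (x * u j) (v j) = ∑ j, F (u j) (v j * x))
    (hc : ∀ a : A, (∀ x, x * a = a * x) → ∃ c : k, algebraMap k A c = a) : IsSimpleRing A := by
  refine IsSimpleRing.of_eq_bot_or_eq_top fun I => ?_
  let N : Submodule k A :=
    { carrier := {a | a ∈ I}
      add_mem' := fun ha hb => I.add_mem ha hb
      zero_mem' := I.zero_mem
      smul_mem' := fun c a ha => by
        change c • a ∈ I
        rw [Algebra.smul_def]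
        exact I.mul_mem_left _ _ ha }
  obtain ⟨q₀, hq₀⟩ := N.subtype.exists_leftInverse_of_injective N.ker_subtype
  let q : A →ₗ[k] A := N.subtype ∘ₗ q₀
  have hqI : ∀ a, q a ∈ I := fun a => (q₀ a).2
  have hq : ∀ a ∈ I, q a = a := fun a ha => congrArg Subtype.val (LinearMap.congr_fun hq₀ ⟨a, ha⟩)
  set e : A := ∑ i, ∑ j, u i * q (v i * u j) * v j with he
  have h1 : ∀ a, a * e = ∑ i, ∑ j, u i * q (v i * a * u j) * v j := fun a => by
    have := hbal (∑ j, LinearMap.mk₂ k (fun r s => r * q (s * u j) * v j)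
      (fun _ _ _ => by simp only [add_mul]) (fun _ _ _ => by simp only [smul_mul_assoc])
      (fun _ _ _ => by simp only [add_mul, map_add, mul_add])
      (fun _ _ _ => by simp only [smul_mul_assoc, map_smul, mul_smul_comm])) a
    simp only [LinearMap.coe_sum, Finset.sum_apply, LinearMap.mk₂_apply] at this
    rw [← this, he, Finset.mul_sum]
    refine Finset.sum_congr rfl fun i _ => ?_
    rw [Finset.mul_sum]
    exact Finset.sum_congr rfl fun j _ => by simp only [mul_assoc]
  have h2 : ∀ a, e * a = ∑ i, ∑ j, u i * q (v i * a * u j) * v j := fun a => by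
    have := hbal (∑ i, LinearMap.mk₂ k (fun r s => u i * q (v i * r) * s)
      (fun _ _ _ => by simp only [add_mul, map_add, mul_add])
      (fun _ _ _ => by simp only [smul_mul_assoc, map_smul, mul_smul_comm])
      (fun _ _ _ => by simp only [mul_add])
      (fun _ _ _ => by simp only [mul_smul_comm])) a
    simp only [LinearMap.coe_sum, Finset.sum_apply, LinearMap.mk₂_apply] at this
    rw [he, Finset.sum_mul]
    simp only [mul_assoc, Finset.sum_mul] at this ⊢
    rw [Finset.sum_comm, ← this, Finset.sum_comm]
  have h3 : ∀ a ∈ I, e * a = a := fun a ha => by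
    rw [h2]
    have : ∀ i j, u i * q (v i * a * u j) * v j = (u i * v i) * a * (u j * v j) := fun i j => by
      rw [hq _ (I.mul_mem_right _ _ (I.mul_mem_left _ _ ha))]
      simp only [mul_assoc]
    simp only [this, ← Finset.mul_sum, huv, ← Finset.sum_mul, mul_one, one_mul]
  have heI : e ∈ I := sum_mem fun i _ => sum_mem fun j _ =>
    I.mul_mem_right _ _ (I.mul_mem_left _ _ (hqI _))
  obtain ⟨c, hce⟩ := hc e fun x => (h1 x).trans (h2 x).symm
  by_cases h0 : c = 0
  · left
    refine eq_bot_iff.2 fun a ha => ?_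
    have h := h3 a ha
    rw [← hce, h0, map_zero, zero_mul] at h
    rw [← h]
    exact zero_mem _
  · right
    refine (TwoSidedIdeal.one_mem_iff I).1 ?_
    have h := I.mul_mem_left (algebraMap k A c⁻¹) _ heI
    rwa [← hce, ← map_mul, inv_mul_cancel₀ h0, map_one] at h

omit [Fintype ι] in
-- The shortest-relation argument: the possible coefficients at i form a two-sided ideal, so a
-- non-zero one could be replaced by 1. The other coefficients are then central, hence scalars, and
-- x = 1 contradicts independence.
theorem eq_zero_of_sum_mul_mul_eq_zero [IsSimpleRing A]
    (hc : ∀ a : A, (∀ x, x * a = a * x) → ∃ c : k, algebraMap k A c = a)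
    {b : ι → A} (hb : LinearIndependent k b) (s : Finset ι) :
    ∀ a : ι → A, (∀ x, ∑ j ∈ s, a j * x * b j = 0) → ∀ j ∈ s, a j = 0 := by
  classical
  induction s using Finset.induction_on with
  | empty => simp
  | insert i s his ih =>
    intro a ha
    have hi : a i = 0 := by
      by_contra hne
      let I : TwoSidedIdeal A := TwoSidedIdeal.mk'
        {z | ∃ a' : ι → A, (∀ x, ∑ j ∈ insert i s, a' j * x * b j = 0) ∧ a' i = z}
        ⟨0, by simp, rfl⟩
        (by
          rintro _ _ ⟨p, hp, rfl⟩ ⟨p', hp', rfl⟩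
          refine ⟨p + p', fun x => ?_, rfl⟩
          simp only [Pi.add_apply, add_mul, Finset.sum_add_distrib, hp, hp', add_zero])
        (by
          rintro _ ⟨p, hp, rfl⟩
          refine ⟨-p, fun x => ?_, rfl⟩
          simp only [Pi.neg_apply, neg_mul, Finset.sum_neg_distrib, hp, neg_zero])
        (by
          rintro r _ ⟨p, hp, rfl⟩
          refine ⟨fun j => r * p j, fun x => ?_, rfl⟩
          simp only [mul_assoc] at hp ⊢
          rw [← Finset.mul_sum, hp, mul_zero])
        (by
          rintro _ r ⟨p, hp, rfl⟩
          refine ⟨fun j => p j * r, fun x => ?_, rfl⟩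
          simp only [mul_assoc] at hp ⊢
          simpa only [mul_assoc] using hp (r * x))
      have haI : a i ∈ I := (TwoSidedIdeal.mem_mk' _ _ _ _ _ _ _).2 ⟨a, ha, rfl⟩
      obtain ⟨p, hp, hp1⟩ := (TwoSidedIdeal.mem_mk' _ _ _ _ _ _ _).1
        (IsSimpleRing.one_mem_of_ne_zero_mem I hne haI)
      simp only [Finset.sum_insert his, hp1, one_mul] at hp
      -- Subtract the relation at c x from c times the relation at x. The term at i cancels because
      -- its coefficient is 1, and induction applies to what remains.
      have hcomm : ∀ j ∈ s, ∀ c, c * p j = p j * c := fun j hj c => by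
        refine sub_eq_zero.1 (ih (fun j => c * p j - p j * c) (fun x => ?_) j hj)
        have h1 := congrArg (c * ·) (hp x)
        have h2 := hp (c * x)
        simp only [mul_add, mul_zero, Finset.mul_sum] at h1
        simp only [sub_mul, Finset.sum_sub_distrib, mul_assoc] at h1 h2 ⊢
        rw [eq_neg_of_add_eq_zero_right h1, eq_neg_of_add_eq_zero_right h2, sub_self]
      have : ∃ d : ι → k, ∀ j ∈ s, algebraMap k A (d j) = p j := by
        choose! d hd using fun j (hj : j ∈ s) => hc (p j) (hcomm j hj)
        exact ⟨d, hd⟩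
      obtain ⟨d, hd⟩ := this
      have h1 := hp 1
      have h2 := linearIndependent_iff'.1 hb (insert i s) (fun j => if j = i then 1 else d j) (by
        rw [Finset.sum_insert his, if_pos rfl, one_smul]
        rw [one_mul] at h1
        rw [← h1]
        congr 1
        refine Finset.sum_congr rfl fun j hj => ?_
        have hji : j ≠ i := by
          rintro rfl
          exact his hj
        rw [if_neg hji, Algebra.smul_def, hd j hj, mul_one]) i
        (Finset.mem_insert_self i s)
      simp at h2
    intro j hj
    rcases Finset.mem_insert.1 hj with rfl | hj
    · exact hi
    · refine ih a (fun x => ?_) j hj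
      simpa [Finset.sum_insert his, hi] using ha x

/-- Over a central simple algebra, `∑ aⱼ ⊗ bⱼ` vanishes if `∑ aⱼ x bⱼ = 0` for all `x`; this is
tested here on the bilinear map `(a, b) ↦ σ(a) b`. -/
theorem sum_map_mul_eq_zero [IsSimpleRing A]
    (hc : ∀ a : A, (∀ x, x * a = a * x) → ∃ c : k, algebraMap k A c = a)
    (a b : ι → A) (h : ∀ x, ∑ j, a j * x * b j = 0) (σ : A →ₗ[k] A) :
    ∑ j, σ (a j) * b j = 0 := by
  classical
  let B := Module.Basis.ofVectorSpace k A
  let S := Finset.univ.biUnion fun j => (B.repr (b j)).support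
  have hb : ∀ j, b j = ∑ i : S, (B.repr (b j) i) • B i := fun j => by
    conv_lhs => rw [← B.linearCombination_repr (b j)]
    rw [Finsupp.linearCombination_apply, Finset.sum_coe_sort S fun i => (B.repr (b j) i) • B i]
    refine Finsupp.sum_of_support_subset _ ?_ _ (by simp)
    exact Finset.subset_biUnion_of_mem (fun j => (B.repr (b j)).support) (Finset.mem_univ j)
  -- Over a basis of the second tensor factor the right entries become independent, so each
  -- collected left entry is already 0.
  have h1 := eq_zero_of_sum_mul_mul_eq_zero (k := k) hc
    (b := fun i : S => B i) (B.linearIndependent.comp _ Subtype.val_injective) Finset.univ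
    (fun i => ∑ j, (B.repr (b j) i) • a j) (fun x => by
      rw [← h x]
      simp only [Finset.sum_mul]
      rw [Finset.sum_comm]
      refine Finset.sum_congr rfl fun j _ => ?_
      conv_rhs => rw [hb j]
      rw [Finset.mul_sum]
      refine Finset.sum_congr rfl fun i _ => ?_
      simp only [smul_mul_assoc, mul_smul_comm])
  calc ∑ j, σ (a j) * b j = ∑ j, ∑ i : S, σ ((B.repr (b j) i) • a j) * B i := by
        refine Finset.sum_congr rfl fun j _ => ?_
        conv_lhs => rw [hb j]
        rw [Finset.mul_sum]
        refine Finset.sum_congr rfl fun i _ => ?_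
        rw [map_smul, smul_mul_assoc, mul_smul_comm]
    _ = ∑ i : S, σ (∑ j, (B.repr (b j) i) • a j) * B i := by
        rw [Finset.sum_comm]
        refine Finset.sum_congr rfl fun i _ => ?_
        rw [map_sum, Finset.sum_mul]
    _ = 0 := Finset.sum_eq_zero fun i hi => by rw [h1 i hi, map_zero, zero_mul]

end CentralSeparableOverField

/-! ### Reduction modulo a maximal ideal of the center. -/

/-- `π : R → A` is the reduction of `R` modulo the ideal `m` of its center `C(R)`, and
`κ : C(R) → k` is the reduction of `C(R)`. -/
structure IsResidue {R k A : Type*} [Ring R] [Field k] [Ring A] [Algebra k A]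
    (m : Ideal (Subring.center R)) (π : R →+* A) (κ : Subring.center R →+* k) : Prop where
  surjective : Function.Surjective π
  surjective_center : Function.Surjective κ
  map_center : ∀ c : Subring.center R, π c = algebraMap k A (κ c)
  center_eq_zero : ∀ c, κ c = 0 ↔ c ∈ m
  mem_of_eq_zero : ∀ r, π r = 0 →
    r ∈ Submodule.span (Subring.center R) {z : R | ∃ c ∈ m, ∃ s, z = c * s}

/-- Reduction of a ring modulo a maximal ideal of its center. -/
theorem exists_residueAlgebra {R : Type u} [Ring R] (m : Ideal (Subring.center R))
    (hm : m.IsMaximal) :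
    ∃ (k A : Type u) (_ : Field k) (_ : Ring A) (_ : Algebra k A) (π : R →+* A)
      (κ : Subring.center R →+* k), IsResidue m π κ := by
  let I : Ideal R := m.map (algebraMap (Subring.center R) R)
  have : I.IsTwoSided := ⟨fun {a} b ha => by
    induction ha using Submodule.span_induction with
    | mem x hx =>
      obtain ⟨c, hc, rfl⟩ := hx
      rw [show algebraMap (Subring.center R) R c * b = b * algebraMap (Subring.center R) R c from
        (Algebra.commutes c b)]
      exact I.mul_mem_left b (Ideal.mem_map_of_mem _ hc)
    | zero => simp
    | add x y _ _ hx hy => rw [add_mul]; exact I.add_mem hx hy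
    | smul r x _ hx => rw [smul_eq_mul, mul_assoc]; exact I.mul_mem_left r hx⟩
  let _ : Field (Subring.center R ⧸ m) := Ideal.Quotient.field m
  let φ : Subring.center R ⧸ m →+* R ⧸ I := Ideal.Quotient.lift m
    ((Ideal.Quotient.mk I).comp (algebraMap (Subring.center R) R)) fun c hc =>
      Ideal.Quotient.eq_zero_iff_mem.2 (Ideal.mem_map_of_mem _ hc)
  let _ : Algebra (Subring.center R ⧸ m) (R ⧸ I) := φ.toAlgebra' fun c x => by
    obtain ⟨c, rfl⟩ := Ideal.Quotient.mk_surjective c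
    obtain ⟨x, rfl⟩ := Ideal.Quotient.mk_surjective x
    change Ideal.Quotient.mk I _ * _ = _ * Ideal.Quotient.mk I _
    rw [← map_mul, ← map_mul, Algebra.commutes]
  refine ⟨Subring.center R ⧸ m, R ⧸ I, inferInstance, inferInstance, inferInstance,
    Ideal.Quotient.mk I, Ideal.Quotient.mk m, ⟨Ideal.Quotient.mk_surjective,
    Ideal.Quotient.mk_surjective, fun c => rfl, fun c => Ideal.Quotient.eq_zero_iff_mem,
    fun r hr => ?_⟩⟩
  have hr' : r ∈ I := Ideal.Quotient.eq_zero_iff_mem.1 hr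
  induction hr' using Submodule.span_induction with
  | mem x hx =>
    obtain ⟨c, hc, rfl⟩ := hx
    exact Submodule.subset_span ⟨c, hc, 1, (mul_one _).symm⟩
  | zero => exact zero_mem _
  | add x y hx' hy' hx hy =>
    exact add_mem (hx (Ideal.Quotient.eq_zero_iff_mem.2 hx'))
      (hy (Ideal.Quotient.eq_zero_iff_mem.2 hy'))
  | smul r x hx' hx =>
    have h := hx (Ideal.Quotient.eq_zero_iff_mem.2 hx')
    clear hx hx' hr
    induction h using Submodule.span_induction with
    | mem x hx =>
      obtain ⟨c, hc, s, rfl⟩ := hx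
      refine Submodule.subset_span ⟨c, hc, r * s, ?_⟩
      rw [smul_eq_mul, ← mul_assoc, Subring.mem_center_iff.1 c.2 r, mul_assoc]
    | zero => simp
    | add x y _ _ hx hy => rw [smul_add]; exact add_mem hx hy
    | smul c x _ hx => rw [smul_comm]; exact Submodule.smul_mem _ c hx

/-! ### Separability of R, and the retractions onto J_g and C(R). -/

namespace UnitalGroupoidAction

namespace GaloisCoordinates

variable {K G : Type*} {R : Type u} [CommRing K] [Groupoid G] [Fintype G]
  [∀ a b : G, Fintype (a ⟶ b)]
  [Ring R] [Algebra K R] {β : UnitalGroupoidAction K G R} (D : β.GaloisCoordinates)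

/-- The left half of a separability family of `R` over `C(R)^β`. -/
def u (p : Fin D.m × Fin D.n) : R := D.x p.1 * D.s p.2

/-- The right half of a separability family of `R` over `C(R)^β`. -/
def v (p : Fin D.m × Fin D.n) : R := D.t p.2 * D.y p.1

/-- Transitivity of separability: x xᵢ = Σₖ xₖ tr(yₖ x xᵢ), the family of R^β moves these traces
from the sⱼ to the tⱼ, and there they reassemble yₖ x. -/
theorem sepFamily : IsSepFamily {z | z ∈ Subring.center R ∧ z ∈ β.invariants ⊤}
    (Set.univ : Set R) D.u D.v := by
  have hW : (⊤ : Subgroupoid G).IsWide := ⟨fun _ => trivial⟩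
  constructor
  · rw [Fintype.sum_prod_type, ← D.sum_x_mul_y]
    refine Finset.sum_congr rfl fun i _ => ?_
    calc ∑ j, D.u (i, j) * D.v (i, j) = D.x i * (∑ j, D.s j * D.t j) * D.y i := by
          rw [Finset.mul_sum, Finset.sum_mul]
          exact Finset.sum_congr rfl fun j _ => by simp only [u, v, mul_assoc]
      _ = D.x i * D.y i := by rw [D.sep.1, _root_.mul_one]
  · intro M _ F hl hr hb x _
    have Fl : ∀ {ι : Type} (T : Finset ι) (f : ι → R) s,
        F (∑ i ∈ T, f i) s = ∑ i ∈ T, F (f i) s := fun T f s =>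
      map_sum (AddMonoidHom.mk' (fun r => F r s) fun r r' => hl r r' s) f T
    have Fr : ∀ {ι : Type} (T : Finset ι) (f : ι → R) s,
        F s (∑ i ∈ T, f i) = ∑ i ∈ T, F s (f i) := fun T f s =>
      map_sum (AddMonoidHom.mk' (fun r => F s r) fun r r' => hr s r r') f T
    have h1 : ∀ i j, F (x * D.u (i, j)) (D.v (i, j)) = ∑ k,
        F (D.x k * (β.tr ⊤ (D.y k * (x * D.x i)) * D.s j)) (D.t j * D.y i) := fun i j => by
      rw [← Fl]
      congr 1
      simp only [← mul_assoc, ← Finset.sum_mul]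
      rw [u, ← mul_assoc]
      congr 1
      conv_lhs => rw [← D.sum_x_tr hW (x * D.x i)]
      simp only [mul_assoc]
    have h2 : ∀ i k, ∑ j, F (D.x k * (β.tr ⊤ (D.y k * (x * D.x i)) * D.s j)) (D.t j * D.y i) =
        ∑ j, F (D.x k * D.s j) (D.t j * β.tr ⊤ (D.y k * (x * D.x i)) * D.y i) := fun i k =>
      D.sep.2 M (fun r s => F (D.x k * r) (s * D.y i)) (fun _ _ _ => by rw [mul_add, hl])
        (fun _ _ _ => by rw [add_mul, hr]) (fun z hz r s => by
          rw [← mul_assoc, hb z hz, mul_assoc]) _ (D.tr_mem_invariants ⊤ _)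
    have h3 : ∀ k j, F (D.u (k, j)) (D.v (k, j) * x) =
        ∑ i, F (D.x k * D.s j) (D.t j * β.tr ⊤ (D.y k * (x * D.x i)) * D.y i) := fun k j => by
      rw [← Fr, u, v]
      congr 1
      simp only [mul_assoc, ← Finset.mul_sum]
      congr 1
      simp only [← mul_assoc]
      exact (D.sum_tr_y hW _).symm
    rw [Fintype.sum_prod_type, Fintype.sum_prod_type]
    simp only [h1, h3]
    have h4 : ∀ i, ∑ j, ∑ k,
        F (D.x k * (β.tr ⊤ (D.y k * (x * D.x i)) * D.s j)) (D.t j * D.y i) =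
        ∑ k, ∑ j, F (D.x k * D.s j) (D.t j * β.tr ⊤ (D.y k * (x * D.x i)) * D.y i) := fun i => by
      rw [Finset.sum_comm]
      exact Finset.sum_congr rfl fun k _ => h2 i k
    simp only [h4]
    rw [Finset.sum_comm]
    exact Finset.sum_congr rfl fun k _ => Finset.sum_comm

/-- The retraction `r ↦ ∑ uⱼ r β_g(vⱼ)` of `R` onto `J_g`. -/
def proj {a b : G} (g : a ⟶ b) (r : R) : R := ∑ j, D.u j * r * β.act g (D.v j)

/-- The separability family slides x through (p, q) ↦ p r β_g(q), which is balanced over the central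
invariants. -/
theorem proj_mem {a b : G} (g : a ⟶ b) (r : R) : D.proj g r ∈ β.J g := by
  refine ⟨sum_mem fun i _ => β.mul_mem_left b _ (β.act_mem g _), fun x => ?_⟩
  have h := D.sepFamily.2 R (fun p q => p * r * β.act g q) (fun _ _ _ => by simp only [add_mul])
    (fun _ _ _ => by rw [act_add, mul_add]) (fun z hz p q => by
      rw [act_mul, β.mem_invariants_top.1 hz.2, mul_assoc z, one_mul_act]
      have := Subring.mem_center_iff.1 hz.1 r
      simp only [mul_assoc]
      rw [← mul_assoc z, ← this, mul_assoc]) x trivial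
  rw [proj, Finset.sum_mul, Finset.mul_sum]
  refine Eq.trans ?_ (h.symm.trans ?_)
  · exact Finset.sum_congr rfl fun i _ => by rw [act_mul, mul_assoc]
  · exact Finset.sum_congr rfl fun i _ => by simp only [mul_assoc]

/-- The retraction `r ↦ ∑ uⱼ r vⱼ` of `R` onto its center. -/
def toCenter : R →ₗ[Subring.center R] Subring.center R where
  toFun r := ⟨∑ j, D.u j * r * D.v j, Subring.mem_center_iff.2 fun x => by
    have h := D.sepFamily.2 R (fun p q => p * r * q) (fun _ _ _ => by simp only [add_mul])
      (fun _ _ _ => by rw [mul_add]) (fun z hz p q => by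
        have := Subring.mem_center_iff.1 hz.1 r
        simp only [mul_assoc]
        rw [← mul_assoc z, ← this, mul_assoc]) x trivial
    rw [Finset.sum_mul, Finset.mul_sum]
    simp only [mul_assoc] at h ⊢
    exact h⟩
  map_add' r s := Subtype.ext (by
    change ∑ j, D.u j * (r + s) * D.v j = ∑ j, D.u j * r * D.v j + ∑ j, D.u j * s * D.v j
    simp only [mul_add, add_mul, Finset.sum_add_distrib])
  map_smul' c r := Subtype.ext (by
    change ∑ j, D.u j * ((c : R) * r) * D.v j = c * ∑ j, D.u j * r * D.v j
    rw [Finset.mul_sum]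
    refine Finset.sum_congr rfl fun j _ => ?_
    rw [← mul_assoc, Subring.mem_center_iff.1 c.2]
    simp only [mul_assoc])

theorem coe_toCenter (r : R) : (D.toCenter r : R) = ∑ j, D.u j * r * D.v j := rfl

theorem toCenter_coe (c : Subring.center R) : D.toCenter (c : R) = c := by
  apply Subtype.ext
  rw [coe_toCenter]
  have h : ∀ j, D.u j * c * D.v j = c * (D.u j * D.v j) := fun j => by
    rw [Subring.mem_center_iff.1 c.2, mul_assoc]
  simp only [h]
  rw [← Finset.mul_sum, D.sepFamily.1, _root_.mul_one]

theorem toCenter_mem {m : Ideal (Subring.center R)} {r : R}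
    (hr : r ∈ Submodule.span (Subring.center R) {z : R | ∃ c ∈ m, ∃ s, z = c * s}) :
    D.toCenter r ∈ m := by
  induction hr using Submodule.span_induction with
  | mem x hx =>
    obtain ⟨c, hc, s, rfl⟩ := hx
    rw [show (c : R) * s = c • s from rfl, map_smul]
    exact m.mul_mem_right _ hc
  | zero => rw [map_zero]; exact zero_mem _
  | add x y _ _ hx hy => rw [map_add]; exact add_mem hx hy
  | smul c x _ hx => rw [map_smul]; exact m.mul_mem_left _ hx

end GaloisCoordinates

end UnitalGroupoidAction

/-! ### Central simple residue algebras and the idempotents of J_g J_{g⁻¹}. -/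

namespace UnitalGroupoidAction

theorem J_mul_J_center {K G R : Type*} [CommRing K] [Groupoid G] [Ring R] [Algebra K R]
    (β : UnitalGroupoidAction K G R) {e : G} {g : e ⟶ e} {y z : R} (hy : y ∈ β.J g)
    (hz : z ∈ β.J (Groupoid.inv g)) : y * z ∈ Subring.center R := by
  have := β.J_comp hy hz
  rw [Groupoid.comp_inv] at this
  exact β.J_id_center this

namespace GaloisCoordinates

variable {K G : Type*} {R : Type u} [CommRing K] [Groupoid G] [Fintype G]
  [∀ a b : G, Fintype (a ⟶ b)]
  [Ring R] [Algebra K R] {β : UnitalGroupoidAction K G R} (D : β.GaloisCoordinates)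

section Residue

variable {k A : Type u} [Field k] [Ring A] [Algebra k A] {m : Ideal (Subring.center R)}
  {π : R →+* A} {κ : Subring.center R →+* k} (h : IsResidue m π κ)

include D h

/-- The C(R)-linear retraction `toCenter` shows that mR meets C(R) only in m. -/
theorem residue_center_eq_zero {c : Subring.center R} : π c = 0 ↔ c ∈ m := by
  constructor
  · intro hc
    have h1 := D.toCenter_mem (h.mem_of_eq_zero c hc)
    rwa [D.toCenter_coe] at h1
  · intro hc
    rw [h.map_center, (h.center_eq_zero c).2 hc, map_zero]

theorem residue_nontrivial (hm : m ≠ ⊤) : Nontrivial A := by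
  refine ⟨1, 0, fun h1 => hm ((Ideal.eq_top_iff_one m).2 ?_)⟩
  rw [← D.residue_center_eq_zero h]
  simpa using h1

/-- For a lift r of a the element Σ uⱼ r vⱼ is central, and its image is a since a commutes with all
π(uⱼ). -/
theorem residue_central (a : A) (ha : ∀ x, x * a = a * x) : ∃ c : k, algebraMap k A c = a := by
  obtain ⟨r, rfl⟩ := h.surjective a
  refine ⟨κ (D.toCenter r), ?_⟩
  rw [← h.map_center, coe_toCenter, map_sum]
  have h1 : ∀ j, π (D.u j * r * D.v j) = π r * π (D.u j * D.v j) := fun j => by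
    simp only [map_mul]
    rw [ha, mul_assoc]
  simp only [h1]
  rw [← Finset.mul_sum, ← map_sum, D.sepFamily.1, map_one, _root_.mul_one]

theorem residue_isSimpleRing (hm : m ≠ ⊤) : IsSimpleRing A := by
  have := D.residue_nontrivial h hm
  refine isSimpleRing_of_separable_of_central (k := k) (fun j => π (D.u j)) (fun j => π (D.v j))
    ?_ (fun F x => ?_) (D.residue_central h)
  · simp only [← map_mul, ← map_sum]
    rw [D.sepFamily.1, map_one]
  · obtain ⟨r, rfl⟩ := h.surjective x
    have h1 := D.sepFamily.2 A (fun p q => F (π p) (π q))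
      (fun _ _ _ => by rw [map_add, map_add, LinearMap.add_apply])
      (fun _ _ _ => by rw [map_add, map_add]) (fun z hz p q => by
        have hz1 : π z = algebraMap k A (κ ⟨z, hz.1⟩) := h.map_center ⟨z, hz.1⟩
        rw [π.map_mul, π.map_mul, hz1, ← Algebra.commutes, ← Algebra.smul_def, ← Algebra.smul_def,
          map_smul, map_smul, LinearMap.smul_apply]) r trivial
    simpa only [map_mul] using h1

/-- An arrow acting trivially on the center modulo `m` satisfies `J_g J_{g⁻¹} ⊄ m`. -/
theorem exists_J_mul_J (hm : m ≠ ⊤) {e : G} (he : π (β.one e) = 1) (g : e ⟶ e)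
    (hg : ∀ c : Subring.center R, π (β.act g c) = π c) :
    ∃ y ∈ β.J g, ∃ z ∈ β.J (Groupoid.inv g), π (y * z) = 1 := by
  have := D.residue_nontrivial h hm
  have := D.residue_isSimpleRing h hm
  have hker : ∀ r, π r = 0 → π (β.act g r) = 0 := by
    intro r hr
    have h1 := h.mem_of_eq_zero r hr
    clear hr
    induction h1 using Submodule.span_induction with
    | mem x hx =>
      obtain ⟨c, hc, s, rfl⟩ := hx
      rw [act_mul, map_mul, hg, (D.residue_center_eq_zero h).2 hc, zero_mul]
    | zero => rw [act_zero, map_zero]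
    | add x y _ _ hx hy => rw [act_add, map_add, hx, hy, add_zero]
    | smul c x _ hx =>
      change π (β.act g ((c : R) * x)) = 0
      rw [act_mul, map_mul, hx, mul_zero]
  have hwd : ∀ r s, π r = π s → π (β.act g r) = π (β.act g s) := fun r s hrs => by
    rw [← sub_eq_zero, ← map_sub, ← act_sub]
    exact hker _ (by rw [map_sub, hrs, sub_self])
  let l := Function.surjInv h.surjective
  have hl : ∀ a, π (l a) = a := Function.surjInv_eq h.surjective
  let σ : A →ₗ[k] A :=
    { toFun := fun a => π (β.act g (l a))
      map_add' := fun a b => by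
        rw [← map_add, ← act_add]
        exact hwd _ _ (by rw [hl, map_add, hl, hl])
      map_smul' := fun c a => by
        obtain ⟨c, rfl⟩ := h.surjective_center c
        rw [RingHom.id_apply, Algebra.smul_def, Algebra.smul_def, ← h.map_center]
        nth_rewrite 2 [← hg]
        rw [← map_mul, ← act_mul]
        exact hwd _ _ (by rw [hl, map_mul, hl]) }
  have hσ : ∀ r, σ (π r) = π (β.act g r) := fun r => hwd _ _ (hl _)
  -- If all these values were 0, then Σ π(uⱼ) ⊗ π(β_g(vⱼ)) would be 0; applying σ to the left factor
  -- and multiplying would give π(1_e) = 0.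
  obtain ⟨r, hr⟩ : ∃ r, π (D.proj g r) ≠ 0 := by
    by_contra! hcon
    have h1 := sum_map_mul_eq_zero (k := k) (D.residue_central h) (fun j => π (D.u j))
      (fun j => π (β.act g (D.v j))) (fun x => by
        obtain ⟨r, rfl⟩ := h.surjective x
        have := hcon r
        rw [proj, map_sum] at this
        simpa only [map_mul] using this) σ
    simp only [hσ, ← map_mul, ← act_mul, ← map_sum, ← act_sum] at h1
    rw [D.sepFamily.1, act_one, he] at h1
    exact one_ne_zero h1
  set y := D.proj g r with hy
  have hyJ : y ∈ β.J g := D.proj_mem g r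
  -- Since x y = y β_g(x), the image of yR is a two-sided ideal of the simple ring A, and it is not
  -- 0.
  obtain ⟨t, ht⟩ : ∃ t, π (y * t) = 1 := by
    let I : TwoSidedIdeal A := TwoSidedIdeal.mk' {a | ∃ t, π (y * t) = a}
      ⟨0, by rw [mul_zero, map_zero]⟩
      (by rintro _ _ ⟨t, rfl⟩ ⟨t', rfl⟩; exact ⟨t + t', by rw [mul_add, map_add]⟩)
      (by rintro _ ⟨t, rfl⟩; exact ⟨-t, by rw [mul_neg, map_neg]⟩)
      (by
        rintro x _ ⟨t, rfl⟩
        obtain ⟨x, rfl⟩ := h.surjective x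
        exact ⟨β.act g x * t, by rw [← mul_assoc, hyJ.2, ← map_mul, mul_assoc]⟩)
      (by
        rintro _ x ⟨t, rfl⟩
        obtain ⟨x, rfl⟩ := h.surjective x
        exact ⟨t * x, by rw [← mul_assoc, map_mul]⟩)
    have hyI : π y ∈ I := (TwoSidedIdeal.mem_mk' _ _ _ _ _ _ _).2 ⟨1, by rw [_root_.mul_one]⟩
    have h1 := (TwoSidedIdeal.mem_mk' _ _ _ _ _ _ _).1
      (IsSimpleRing.one_mem_of_ne_zero_mem I hr hyI)
    exact h1
  -- Moving y past the uⱼ turns them into β_{g⁻¹}(uⱼ); then y t ≡ 1 leaves β_{g⁻¹}(Σ uⱼvⱼ) = 1_e.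
  refine ⟨y, hyJ, D.proj (Groupoid.inv g) t, D.proj_mem _ t, ?_⟩
  rw [proj, Finset.mul_sum, map_sum]
  have h1 : ∀ j, π (y * (D.u j * t * β.act (Groupoid.inv g) (D.v j))) =
      π (β.act (Groupoid.inv g) (D.u j * D.v j)) := fun j => by
    have h2 : y * D.u j = β.act (Groupoid.inv g) (D.u j) * y := by
      rw [← hyJ.2, act_act_inv, ← β.one_comm, ← mul_assoc, β.J_mul_one hyJ]
    rw [← mul_assoc, ← mul_assoc, h2, mul_assoc (β.act _ _) y t, map_mul, map_mul, ht,
      _root_.mul_one, ← map_mul, act_mul]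
  simp only [h1]
  rw [← map_sum, ← act_sum, D.sepFamily.1, act_one, he]

end Residue

include D in
-- No maximal ideal contains J_g J_{g⁻¹}, all c − β_g(c) and 1 − 1_e, by `exists_J_mul_J`. These
-- therefore generate C(R); cut the resulting expression of 1 by 1_e.
theorem exists_loopIdempotent {e : G} (g : e ⟶ e) :
    ∃ (l : ℕ) (p q : Fin l → R), (∀ i, p i ∈ β.J g) ∧ (∀ i, q i ∈ β.J (Groupoid.inv g)) ∧
      ∃ κ ∈ Ideal.span (Set.range fun c : Subring.center R => c - β.actCenter g c),
        (κ : R) = β.one e - ∑ i, p i * q i := by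
  let I : Ideal (Subring.center R) :=
    Ideal.span {c | ∃ y ∈ β.J g, ∃ z ∈ β.J (Groupoid.inv g), (c : R) = y * z}
  let I' : Ideal (Subring.center R) :=
    Ideal.span (Set.range fun c : Subring.center R => c - β.actCenter g c)
  let o : Subring.center R := ⟨β.one e, β.one_central e⟩
  have htop : I ⊔ I' ⊔ Ideal.span {1 - o} = ⊤ := by
    by_contra hne
    obtain ⟨m, hm, hle⟩ := Ideal.exists_le_maximal _ hne
    obtain ⟨k, A, _, _, _, π, κ, hres⟩ := exists_residueAlgebra m hm
    have ho : π (β.one e) = 1 := by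
      have h1 : (1 - o) ∈ m := hle (Ideal.mem_sup_right (Ideal.mem_span_singleton_self _))
      rw [← D.residue_center_eq_zero hres] at h1
      have h2 : π (1 - β.one e) = 0 := h1
      rw [map_sub, map_one, sub_eq_zero] at h2
      exact h2.symm
    have hg : ∀ c : Subring.center R, π (β.act g c) = π c := fun c => by
      have h1 : c - β.actCenter g c ∈ m :=
        hle (Ideal.mem_sup_left (Ideal.mem_sup_right (Ideal.subset_span ⟨c, rfl⟩)))
      rw [← D.residue_center_eq_zero hres] at h1
      have h2 : π (c - β.act g c) = 0 := h1
      rw [map_sub, sub_eq_zero] at h2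
      exact h2.symm
    have := D.residue_nontrivial hres hm.ne_top
    obtain ⟨y, hy, z, hz, hyz⟩ := D.exists_J_mul_J hres hm.ne_top ho g hg
    have h1 : (⟨y * z, β.J_mul_J_center hy hz⟩ : Subring.center R) ∈ m :=
      hle (Ideal.mem_sup_left (Ideal.mem_sup_left (Ideal.subset_span ⟨y, hy, z, hz, rfl⟩)))
    rw [← D.residue_center_eq_zero hres] at h1
    exact one_ne_zero (hyz.symm.trans h1)
  have h1 : (1 : Subring.center R) ∈ I ⊔ I' ⊔ Ideal.span {1 - o} := by rw [htop]; trivial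
  obtain ⟨w, hw, d, hd, hwd⟩ := Submodule.mem_sup.1 h1
  obtain ⟨i, hi, i', hi', rfl⟩ := Submodule.mem_sup.1 hw
  obtain ⟨b, rfl⟩ := Ideal.mem_span_singleton'.1 hd
  have hoo : o * o = o := Subtype.ext (β.one_idem e)
  have h2 : o = o * i + o * i' := by
    have := congrArg (o * ·) hwd
    simp only [mul_add, mul_sub, _root_.mul_one] at this
    rw [mul_left_comm o b o, hoo, mul_comm b o, sub_self, add_zero] at this
    exact this.symm
  have key : ∀ c ∈ I, ∃ (l : ℕ) (p q : Fin l → R), (∀ i, p i ∈ β.J g) ∧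
      (∀ i, q i ∈ β.J (Groupoid.inv g)) ∧ (c : R) = ∑ i, p i * q i := by
    intro c hc
    induction hc using Submodule.span_induction with
    | mem x hx =>
      obtain ⟨y, hy, z, hz, h⟩ := hx
      exact ⟨1, fun _ => y, fun _ => z, fun _ => hy, fun _ => hz, by simpa using h⟩
    | zero => exact ⟨0, Fin.elim0, Fin.elim0, fun i => i.elim0, fun i => i.elim0, by simp⟩
    | add x y _ _ hx hy =>
      obtain ⟨l, p, q, hp, hq, h⟩ := hx
      obtain ⟨l', p', q', hp', hq', h'⟩ := hy
      refine ⟨l + l', Fin.addCases p p', Fin.addCases q q', fun i => ?_, fun i => ?_, ?_⟩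
      · induction i using Fin.addCases <;> simp [hp, hp']
      · induction i using Fin.addCases with
        | left i => simpa only [Fin.addCases_left] using hq i
        | right i => simpa only [Fin.addCases_right] using hq' i
      · simp [Fin.sum_univ_add, h, h']
    | smul c x _ hx =>
      obtain ⟨l, p, q, hp, hq, h⟩ := hx
      refine ⟨l, fun i => c * p i, q, fun i => β.center_mul_J c.2 (hp i), hq, ?_⟩
      change (c : R) * x = _
      rw [h, Finset.mul_sum]
      exact Finset.sum_congr rfl fun i _ => (mul_assoc _ _ _).symm
  obtain ⟨l, p, q, hp, hq, h⟩ := key (o * i) (I.mul_mem_left _ hi)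
  refine ⟨l, p, q, hp, hq, o * i', I'.mul_mem_left _ hi', ?_⟩
  rw [← h]
  have h3 := congrArg Subtype.val h2
  change β.one e = (o * i : Subring.center R) + (o * i' : Subring.center R) at h3
  rw [h3, add_sub_cancel_left]

/-- The number of terms of the loop idempotent of `g`. -/
noncomputable def len {e : G} (g : e ⟶ e) : ℕ := (D.exists_loopIdempotent g).choose

/-- The elements of `J_g` in the loop idempotent of `g`. -/
noncomputable def p {e : G} (g : e ⟶ e) : Fin (D.len g) → R :=
  (D.exists_loopIdempotent g).choose_spec.choose

/-- The elements of `J_{g⁻¹}` in the loop idempotent of `g`. -/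
noncomputable def q {e : G} (g : e ⟶ e) : Fin (D.len g) → R :=
  (D.exists_loopIdempotent g).choose_spec.choose_spec.choose

/-- The central idempotent generating `J_g J_{g⁻¹}`. -/
noncomputable def eps {e : G} (g : e ⟶ e) : R := ∑ i, D.p g i * D.q g i

variable {e : G} (g : e ⟶ e)

theorem p_mem (i) : D.p g i ∈ β.J g :=
  (D.exists_loopIdempotent g).choose_spec.choose_spec.choose_spec.1 i

theorem q_mem (i) : D.q g i ∈ β.J (Groupoid.inv g) :=
  (D.exists_loopIdempotent g).choose_spec.choose_spec.choose_spec.2.1 i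

theorem one_sub_eps :
    ∃ κ ∈ Ideal.span (Set.range fun c : Subring.center R => c - β.actCenter g c),
        (κ : R) = β.one e - D.eps g :=
  (D.exists_loopIdempotent g).choose_spec.choose_spec.choose_spec.2.2

theorem eps_center : D.eps g ∈ Subring.center R :=
  sum_mem fun i _ => β.J_mul_J_center (D.p_mem g i) (D.q_mem g i)

theorem eps_mem : D.eps g ∈ β.E e :=
  sum_mem fun i _ => β.mul_mem_left e _ (D.q_mem g i).1

omit [∀ a b : G, Fintype (a ⟶ b)] [Fintype G] in
theorem span_mul_eq_zero {κ : Subring.center R}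
    (hκ : κ ∈ Ideal.span (Set.range fun c : Subring.center R => c - β.actCenter g c)) {y : R}
    (hy : ∀ c ∈ Subring.center R, β.act g c * y = c * y) : (κ : R) * y = 0 := by
  induction hκ using Submodule.span_induction with
  | mem x hx =>
    obtain ⟨c, rfl⟩ := hx
    change ((c : R) - β.act g c) * y = 0
    rw [sub_mul, hy c c.2, sub_self]
  | zero => exact zero_mul y
  | add a b _ _ ha hb =>
    change ((a : R) + b) * y = 0
    rw [add_mul, ha, hb, add_zero]
  | smul c x _ hx =>
    change (c : R) * x * y = 0
    rw [mul_assoc, hx, mul_zero]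

/-- Every c − β_g(c) kills y, hence so does 1_e − ε_g. -/
theorem eps_mul_of_act {y : R} (hyE : y ∈ β.E e)
    (hy : ∀ c ∈ Subring.center R, β.act g c * y = c * y) : D.eps g * y = y := by
  obtain ⟨κ, hκ, h⟩ := D.one_sub_eps g
  have h1 := span_mul_eq_zero g hκ hy
  rw [h, sub_mul, β.one_mul e hyE, sub_eq_zero] at h1
  exact h1.symm

variable {g}

theorem eps_mul_J {y : R} (hy : y ∈ β.J g) : D.eps g * y = y :=
  D.eps_mul_of_act g hy.1 fun c hc => by
    rw [← Subring.mem_center_iff.1 (β.act_center g hc), hy.2]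

theorem eps_mul_J_inv {y : R} (hy : y ∈ β.J (Groupoid.inv g)) : D.eps g * y = y :=
  D.eps_mul_of_act g hy.1 fun c hc => by
    rw [β.J_inv hy, Subring.mem_center_iff.1 hc]

variable (g)

theorem eps_idem : D.eps g * D.eps g = D.eps g := by
  nth_rewrite 2 [eps]
  rw [Finset.mul_sum, eps]
  exact Finset.sum_congr rfl fun i _ => by
    rw [← mul_assoc, ← eps, D.eps_mul_J (D.p_mem g i)]

/-- ε_g is the identity on J_{g⁻¹} as well, so the two central idempotents absorb each other. -/
theorem eps_inv : D.eps (Groupoid.inv g) = D.eps g := by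
  have h1 : D.eps g * D.eps (Groupoid.inv g) = D.eps (Groupoid.inv g) := by
    have hs : D.eps (Groupoid.inv g) =
      ∑ i, D.p (Groupoid.inv g) i * D.q (Groupoid.inv g) i := rfl
    rw [hs, Finset.mul_sum]
    refine Finset.sum_congr rfl fun i _ => ?_
    rw [← mul_assoc, D.eps_mul_J_inv (D.p_mem _ i)]
  have h2 : D.eps (Groupoid.inv g) * D.eps g = D.eps g := by
    have hs : D.eps g = ∑ i, D.p g i * D.q g i := rfl
    rw [hs, Finset.mul_sum]
    refine Finset.sum_congr rfl fun i _ => ?_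
    have h3 : D.p g i ∈ β.J (Groupoid.inv (Groupoid.inv g)) := by
      have : Groupoid.inv (Groupoid.inv g) = g := by simp
      rw [this]
      exact D.p_mem g i
    rw [← mul_assoc, D.eps_mul_J_inv h3]
  rw [← h1, ← Subring.mem_center_iff.1 (D.eps_center g), h2]

/-- An element commuting with `J_{g⁻¹}` is fixed by `g` up to `eps g`. -/
theorem eps_mul_act {d : R} (hd : ∀ y ∈ β.J (Groupoid.inv g), y * d = d * y) :
    D.eps g * β.act g d = D.eps g * d := by
  rw [← D.eps_inv g, ← Subring.mem_center_iff.1 (D.eps_center _),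
    ← Subring.mem_center_iff.1 (D.eps_center _), eps, Finset.mul_sum, Finset.mul_sum]
  refine Finset.sum_congr rfl fun i _ => ?_
  rw [← mul_assoc, ← mul_assoc, β.J_inv (D.p_mem _ i), hd _ (D.p_mem _ i)]

theorem eps_id : D.eps (𝟙 e) = β.one e := by
  have h := D.eps_mul_J (g := 𝟙 e) (y := β.one e) ⟨β.one_mem e, fun x => by
    rw [act_id, ← β.one_comm, ← mul_assoc, one_idem, β.one_comm]⟩
  rw [← h, β.mul_one e (D.eps_mem _)]

/-- Since J_g J_h lies in J_{g ≫ h}, the last idempotent is absorbed. This makes the loops with ε ≡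
1 modulo m closed under composition. -/
theorem eps_mul_eps_comp (h : e ⟶ e) : D.eps g * D.eps h * D.eps (g ≫ h) = D.eps g * D.eps h := by
  have h1 : D.eps g * D.eps h = ∑ i, ∑ j, D.p g i * D.p h j * (D.q h j * D.q g i) := by
    have hs : D.eps g = ∑ i, D.p g i * D.q g i := rfl
    rw [hs, Finset.sum_mul]
    refine Finset.sum_congr rfl fun i _ => ?_
    rw [mul_assoc, Subring.mem_center_iff.1 (D.eps_center h), ← mul_assoc, eps, Finset.mul_sum,
      Finset.sum_mul]
    exact Finset.sum_congr rfl fun j _ => by simp only [mul_assoc]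
  rw [Subring.mem_center_iff.1 (D.eps_center (g ≫ h)), h1, Finset.mul_sum]
  refine Finset.sum_congr rfl fun i _ => ?_
  rw [Finset.mul_sum]
  refine Finset.sum_congr rfl fun j _ => ?_
  rw [← mul_assoc, D.eps_mul_J (β.J_comp (D.p_mem g i) (D.p_mem h j))]

end GaloisCoordinates

end UnitalGroupoidAction

/-! ### Traces of central elements and invertibility of the index. -/

theorem Subgroup.sum_eq_zero_of_right_invariant {Γ A : Type*} [Group Γ] [Fintype Γ] [Ring A]
    (I : Subgroup Γ) [Fintype I] (φ : Γ → A) (hφ : ∀ γ, ∀ j ∈ I, φ (γ * j) = φ γ)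
    (hI : (Fintype.card I : A) = 0) : ∑ γ, φ γ = 0 := by
  classical
  -- φ is constant on each left coset of I, which therefore contributes a multiple of |I|.
  let ε : (Γ ⧸ I) × I ≃ Γ :=
    { toFun := fun p => p.1.out * p.2
      invFun := fun γ => (γ, ⟨(γ : Γ ⧸ I).out⁻¹ * γ, QuotientGroup.eq.1 (by simp)⟩)
      left_inv := by
        rintro ⟨c, j⟩
        have h : ((c.out * j : Γ) : Γ ⧸ I) = c := by
          conv_rhs => rw [← QuotientGroup.out_eq' c]
          exact QuotientGroup.eq.2 (by simp)
        refine Prod.ext h (Subtype.ext ?_)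
        change ((c.out * j : Γ) : Γ ⧸ I).out⁻¹ * (c.out * j) = j
        rw [h, inv_mul_cancel_left]
      right_inv := fun γ => mul_inv_cancel_left _ _ }
  rw [← Equiv.sum_comp ε, Fintype.sum_prod_type]
  refine Finset.sum_eq_zero fun c _ => ?_
  have h : ∀ j : I, φ (ε (c, j)) = φ c.out := fun j => hφ _ _ j.2
  simp only [h, Finset.sum_const, Finset.card_univ, nsmul_eq_mul, hI, zero_mul]

namespace UnitalGroupoidAction

namespace GaloisCoordinates

variable {K G : Type*} {R : Type u} [CommRing K] [Groupoid G] [Fintype G]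
  [∀ a b : G, Fintype (a ⟶ b)]
  [Ring R] [Algebra K R] {β : UnitalGroupoidAction K G R} (D : β.GaloisCoordinates)

theorem toCenter_of_mem {v : R} (hv : v ∈ β.centralizerInvariants ⊤) :
    (D.toCenter v : R) = ∑ i, D.x i * v * D.y i := by
  rw [coe_toCenter, Fintype.sum_prod_type]
  refine Finset.sum_congr rfl fun i _ => ?_
  have h : ∀ j, D.u (i, j) * v * D.v (i, j) = D.x i * v * (D.s j * D.t j) * D.y i := fun j => by
    have := hv _ (D.s_mem j)
    simp only [u, GaloisCoordinates.v, mul_assoc] at this ⊢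
    rw [← mul_assoc (D.s j) v, this]
    simp only [mul_assoc]
  simp only [h]
  rw [← Finset.sum_mul, ← Finset.mul_sum, D.sep.1, _root_.mul_one]

theorem toCenter_eq_sum_comp {v : R} (hv : v ∈ β.centralizerInvariants ⊤) :
    (D.toCenter v : R) = ∑ e, D.comp (𝟙 e) v := by
  rw [D.toCenter_of_mem hv]
  simp only [comp]
  rw [Finset.sum_comm]
  refine Finset.sum_congr rfl fun i _ => ?_
  simp only [act_id, ← mul_assoc]
  exact (D.mul_sum_one _).symm

theorem toCenter_J {e : G} {f : e ⟶ e} [Decidable (f = 𝟙 e)] {y : R} (hy : y ∈ β.J f) :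
    (D.toCenter y : R) = if f = 𝟙 e then y else 0 := by
  classical
  have hv : y ∈ β.centralizerInvariants ⊤ :=
    β.J_mem_centralizer (H := ⊤) (g := f) trivial hy
  rw [D.toCenter_eq_sum_comp hv]
  refine (Finset.sum_eq_single e (fun e' _ h => D.comp_of_mem_ne h.symm _ hy.1)
    (fun h => absurd (Finset.mem_univ _) h)).trans ?_
  rw [D.comp_J hy]
  simp only [eq_comm]

/-- On this centralizer `toCenter` is the projection onto the components at identities, and
conjugation by g carries identity components to identity components. -/
theorem toCenter_act_of_mem {a b : G} (g : a ⟶ b) {v : R}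
    (hv : v ∈ β.centralizerInvariants ⊤) :
    (D.toCenter (β.act g v) : R) = β.act g (D.toCenter v) := by
  classical
  have hW : (⊤ : Subgroupoid G).IsWide := ⟨fun _ => trivial⟩
  let W : R →+ R := AddMonoidHom.mk' (fun r => (D.toCenter r : R)) fun r s => by
    rw [map_add]; rfl
  have key : ∀ (e : G) (f : e ⟶ e) (y : R), y ∈ β.J f →
      W (β.act g y) = β.act g (W y) := by
    intro e f y hy
    change (D.toCenter (β.act g y) : R) = β.act g (D.toCenter y)
    by_cases hea : e = a
    · subst hea
      rw [D.toCenter_J hy, D.toCenter_J (β.act_J g hy)]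
      have hiff : Groupoid.inv g ≫ f ≫ g = 𝟙 b ↔ f = 𝟙 e := by
        constructor
        · intro h
          have := congrArg (fun z => g ≫ z ≫ Groupoid.inv g) h
          simpa using this
        · rintro rfl
          simp
      simp only [hiff]
      split_ifs
      · rfl
      · rw [act_zero]
    · rw [D.act_ne hea g hy.1, D.toCenter_J hy, map_zero]
      split_ifs
      · rw [D.act_ne hea g hy.1]
        rfl
      · rw [act_zero]
        rfl
  change W (β.act g v) = β.act g (W v)
  have hs := D.sum_comp hW hv
  have h1 : v = ∑ e : G, ∑ f : e ⟶ e, D.comp f v := by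
    conv_lhs => rw [hs]
    refine Finset.sum_congr rfl fun e _ => Finset.sum_congr rfl fun f _ => ?_
    exact if_pos trivial
  rw [h1]
  simp only [act_sum, map_sum]
  refine Finset.sum_congr rfl fun e _ => Finset.sum_congr rfl fun f _ => ?_
  exact key e f _ (D.comp_mem_J hW (H := ⊤) trivial hv)

/-- Averaging with the sⱼ, tⱼ first moves r into the centralizer of R^β. It does not change
`toCenter`, and it commutes with β_g because sⱼ and tⱼ are invariant. -/
theorem toCenter_act {a b : G} (g : a ⟶ b) (r : R) :
    (D.toCenter (β.act g r) : R) = β.act g (D.toCenter r) := by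
  let Q : R → R := fun r => ∑ j, D.s j * r * D.t j
  have hQ : ∀ r, Q r ∈ β.centralizerInvariants ⊤ := fun r σ hσ => by
    have h := D.sep.2 R (fun p q => p * r * q) (fun _ _ _ => by simp only [add_mul])
      (fun _ _ _ => by rw [mul_add]) (fun z hz p q => by
        have := Subring.mem_center_iff.1 hz.1 r
        simp only [mul_assoc]
        rw [← mul_assoc z, ← this, mul_assoc]) σ hσ
    simp only [Q]
    rw [Finset.sum_mul, Finset.mul_sum]
    simp only [mul_assoc] at h ⊢
    exact h
  have hWQ : ∀ r, (D.toCenter (Q r) : R) = D.toCenter r := fun r => by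
    rw [D.toCenter_of_mem (hQ r), coe_toCenter, Fintype.sum_prod_type]
    refine Finset.sum_congr rfl fun i _ => ?_
    simp only [Q, Finset.mul_sum, Finset.sum_mul]
    exact Finset.sum_congr rfl fun j _ => by simp only [u, v, mul_assoc]
  have hQact : Q (β.act g r) = β.act g (Q r) := by
    simp only [Q]
    rw [act_sum]
    refine Finset.sum_congr rfl fun j _ => ?_
    rw [act_mul, act_mul, β.mem_invariants_top.1 (D.s_mem j), β.mem_invariants_top.1 (D.t_mem j),
      ← β.one_comm b (D.t j)]
    simp only [mul_assoc]
    rw [← mul_assoc (β.act g r) (β.one b), act_mul_one, ← mul_assoc (β.one b), one_mul_act]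
  rw [← hWQ, hQact, D.toCenter_act_of_mem g (hQ r), hWQ]

theorem toCenter_tr (H : Subgroupoid G) (r : R) :
    (D.toCenter (β.tr H r) : R) = β.tr H (D.toCenter r) := by
  let W : R →+ R := AddMonoidHom.mk' (fun r => (D.toCenter r : R)) fun r s => by
    rw [map_add]; rfl
  change W (β.tr H r) = _
  simp only [tr, map_sum]
  refine Finset.sum_congr rfl fun b _ => Finset.sum_congr rfl fun a _ =>
    Finset.sum_congr rfl fun f _ => ?_
  split_ifs
  · exact D.toCenter_act f r
  · exact map_zero W

include D in
theorem span_tr_center : Ideal.span (Set.range fun c : Subring.center R =>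
    (⟨β.tr ⊤ c, β.tr_center ⊤ c.2⟩ : Subring.center R)) = ⊤ := by
  have hW : (⊤ : Subgroupoid G).IsWide := ⟨fun _ => trivial⟩
  by_contra hne
  obtain ⟨m, hm, hle⟩ := Ideal.exists_le_maximal _ hne
  obtain ⟨k, A, _, _, _, π, κ, hres⟩ := exists_residueAlgebra m hm
  let T : Submodule k A := Submodule.span k (π '' (β.invariants ⊤ : Set R))
  obtain ⟨f₀, hf₀⟩ := T.subtype.exists_leftInverse_of_injective T.ker_subtype
  have hf₀T : ∀ a (ha : a ∈ T), (f₀ a : A) = a := fun a ha =>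
    congrArg Subtype.val (LinearMap.congr_fun hf₀ ⟨a, ha⟩)
  have hπT : ∀ {s}, s ∈ β.invariants ⊤ → π s ∈ T := fun hs =>
    Submodule.subset_span ⟨_, hs, rfl⟩
  have hmulT : ∀ {s}, s ∈ β.invariants ⊤ → ∀ t ∈ T, π s * t ∈ T := by
    intro s hs t ht
    induction ht using Submodule.span_induction with
    | mem x hx =>
      obtain ⟨r, hr, rfl⟩ := hx
      rw [← map_mul]
      exact hπT (mul_mem hs hr)
    | zero => rw [mul_zero]; exact zero_mem _
    | add x y _ _ hx hy => rw [mul_add]; exact add_mem hx hy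
    | smul c x _ hx => rw [mul_smul_comm]; exact T.smul_mem c hx
  -- Averaging f₀ over the separability family of R^β makes it π(R^β)-linear; it still fixes 1 and
  -- has values in T. Applied to 1 = Σ tr(xᵢ) yᵢ, it puts 1 into the span N of the traces.
  let f : A →+ A := AddMonoidHom.mk' (fun x => ∑ j, π (D.s j) * f₀ (π (D.t j) * x))
    fun x y => by
      simp only [mul_add, map_add, Submodule.coe_add, Finset.sum_add_distrib]
  have hf : ∀ x, f x = ∑ j, π (D.s j) * f₀ (π (D.t j) * x) := fun x => rfl
  have hfT : ∀ x, f x ∈ T := fun x => by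
    rw [hf]
    exact sum_mem fun j _ => hmulT (D.s_mem j) _ (f₀ _).2
  have hf1 : f 1 = 1 := by
    have h : ∀ j, π (D.s j) * (f₀ (π (D.t j) * 1) : A) = π (D.s j * D.t j) := fun j => by
      rw [_root_.mul_one, hf₀T _ (hπT (D.t_mem j)), map_mul]
    rw [hf]
    simp only [h]
    rw [← map_sum, D.sep.1, map_one]
  have hfmul : ∀ s ∈ β.invariants ⊤, ∀ x, f (π s * x) = π s * f x := by
    intro s hs x
    have h := D.sep.2 A (fun p q => π p * f₀ (π q * x))
      (fun _ _ _ => by rw [map_add, add_mul])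
      (fun _ _ _ => by rw [map_add, add_mul, map_add, Submodule.coe_add, mul_add])
      (fun z hz p q => by
        have hz1 : π z = algebraMap k A (κ ⟨z, hz.1⟩) := hres.map_center ⟨z, hz.1⟩
        rw [π.map_mul, π.map_mul, hz1, mul_assoc, mul_assoc, ← Algebra.smul_def,
          ← Algebra.smul_def, map_smul, Submodule.coe_smul]) s hs
    rw [hf, hf, Finset.mul_sum]
    simp only [map_mul, mul_assoc] at h ⊢
    exact h.symm
  let N : Submodule k A := Submodule.span k (Set.range fun r => π (β.tr ⊤ r))
  have hN : ∀ r, ∀ t ∈ T, π (β.tr ⊤ r) * t ∈ N := by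
    intro r t ht
    induction ht using Submodule.span_induction with
    | mem x hx =>
      obtain ⟨s, hs, rfl⟩ := hx
      rw [← map_mul, ← β.tr_mul hs]
      exact Submodule.subset_span ⟨_, rfl⟩
    | zero => rw [mul_zero]; exact zero_mem _
    | add x y _ _ hx hy => rw [mul_add]; exact add_mem hx hy
    | smul c x _ hx => rw [mul_smul_comm]; exact N.smul_mem c hx
  have h1N : (1 : A) ∈ N := by
    have h1 := congrArg π (D.sum_tr_y hW 1)
    rw [map_one, map_sum] at h1
    rw [← hf1]
    have h2 := congrArg f h1
    rw [map_sum] at h2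
    rw [← h2]
    refine sum_mem fun i _ => ?_
    rw [map_mul, hfmul _ (D.tr_mem_invariants ⊤ _)]
    exact hN _ _ (hfT _)
  -- `toCenter` of a trace is the trace of a central element, hence in m by assumption.
  have key : ∀ a ∈ N, ∃ r, π r = a ∧ D.toCenter r ∈ m := by
    intro a ha
    induction ha using Submodule.span_induction with
    | mem x hx =>
      obtain ⟨r, rfl⟩ := hx
      refine ⟨_, rfl, hle (Ideal.subset_span ⟨D.toCenter r, ?_⟩)⟩
      exact Subtype.ext (D.toCenter_tr ⊤ r).symm
    | zero => exact ⟨0, map_zero _, by rw [map_zero]; exact zero_mem _⟩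
    | add x y _ _ hx hy =>
      obtain ⟨r, rfl, hr⟩ := hx
      obtain ⟨s, rfl, hs⟩ := hy
      exact ⟨r + s, map_add _ _ _, by rw [map_add]; exact add_mem hr hs⟩
    | smul c x _ hx =>
      obtain ⟨r, rfl, hr⟩ := hx
      obtain ⟨c, rfl⟩ := hres.surjective_center c
      refine ⟨c • r, ?_, by rw [map_smul]; exact m.mul_mem_left _ hr⟩
      change π ((c : R) * r) = κ c • π r
      rw [map_mul, hres.map_center, Algebra.smul_def]
  obtain ⟨r, hr, hrm⟩ := key 1 h1N
  have h2 : D.toCenter (1 - r) ∈ m :=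
    D.toCenter_mem (hres.mem_of_eq_zero _ (by rw [map_sub, map_one, hr, sub_self]))
  apply hm.ne_top
  rw [Ideal.eq_top_iff_one]
  have h3 : D.toCenter 1 = 1 := D.toCenter_coe 1
  rw [map_sub, h3] at h2
  have := add_mem h2 hrm
  rwa [sub_add_cancel] at this

open Classical in
/-- The sum of the loop idempotents of a subgroupoid. -/
noncomputable def index (H : Subgroupoid G) : R :=
  ∑ e : G, ∑ f : e ⟶ e, if f ∈ H.arrows e e then D.eps f else 0

theorem index_center (H : Subgroupoid G) : D.index H ∈ Subring.center R := by
  refine sum_mem fun e _ => sum_mem fun f _ => ?_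
  split_ifs
  · exact D.eps_center f
  · exact zero_mem _

theorem isUnit_index {H : Subgroupoid G} (hH : H.IsWide) :
    IsUnit (⟨D.index H, D.index_center H⟩ : Subring.center R) := by
  classical
  by_contra hn
  obtain ⟨m, hm, hnm⟩ := exists_max_ideal_of_mem_nonunits hn
  obtain ⟨k, A, _, _, _, π, κ, hres⟩ := exists_residueAlgebra m hm
  have := D.residue_nontrivial hres hm.ne_top
  have hidem : ∀ c ∈ Subring.center R, c * c = c → π c = 0 ∨ π c = 1 := by
    intro c hc hcc
    have h1 : π c = algebraMap k A (κ ⟨c, hc⟩) := hres.map_center ⟨c, hc⟩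
    have h2 : κ ⟨c, hc⟩ * κ ⟨c, hc⟩ = κ ⟨c, hc⟩ := by
      rw [← map_mul]
      exact congrArg κ (Subtype.ext hcc)
    rcases IsIdempotentElem.iff_eq_zero_or_one.1 h2 with h | h
    · left; rw [h1, h, map_zero]
    · right; rw [h1, h, map_one]
  obtain ⟨e, he⟩ : ∃ e, π (β.one e) ≠ 0 := by
    by_contra! hcon
    have h := congrArg π D.sum_one
    rw [map_sum, map_one, Finset.sum_eq_zero fun e _ => hcon e] at h
    exact zero_ne_one h
  have he1 : π (β.one e) = 1 :=
    (hidem _ (β.one_central e) (β.one_idem e)).resolve_left he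
  have hzero : ∀ b, b ≠ e → ∀ r ∈ β.E b, π r = 0 := fun b hb r hr => by
    have := D.mul_one_ne hb hr
    rw [← _root_.mul_one (π r), ← he1, ← map_mul, this, map_zero]
  -- The inertia group: exactly one object e has π(1_e) ≠ 0, and modulo m the index counts the loops
  -- of H at e with ε ≡ 1.
  let I : Subgroup (e ⟶ e) :=
    { carrier := {f | f ∈ H.arrows e e ∧ π (D.eps f) = 1}
      mul_mem' := by
        rintro f g ⟨hf, hf1⟩ ⟨hg, hg1⟩
        refine ⟨H.mul hf hg, ?_⟩
        have h := congrArg π (D.eps_mul_eps_comp f g)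
        rw [map_mul, map_mul, hf1, hg1, _root_.mul_one, _root_.one_mul] at h
        exact h
      one_mem' := ⟨hH.wide e, by
        change π (D.eps (𝟙 e)) = 1
        rw [D.eps_id, he1]⟩
      inv_mem' := by
        rintro f ⟨hf, hf1⟩
        refine ⟨H.inv hf, ?_⟩
        change π (D.eps (Groupoid.inv f)) = 1
        rw [D.eps_inv, hf1] }
  have hI : (Fintype.card I : A) = 0 := by
    have h0 : π (D.index H) = 0 := (D.residue_center_eq_zero hres).2 hnm
    rw [← h0, index, map_sum]
    symm
    refine (Finset.sum_eq_single e (fun b _ hb => ?_)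
      (fun h => absurd (Finset.mem_univ _) h)).trans ?_
    · refine hzero b hb _ (sum_mem fun f _ => ?_)
      split_ifs
      · exact D.eps_mem f
      · exact zero_mem _
    · rw [map_sum]
      have h1 : ∀ f : e ⟶ e, π (if f ∈ H.arrows e e then D.eps f else 0) =
          if f ∈ I then 1 else 0 := by
        intro f
        by_cases hf : f ∈ H.arrows e e
        · rw [if_pos hf]
          rcases hidem _ (D.eps_center f) (D.eps_idem f) with h | h
          · rw [if_neg, h]
            rintro ⟨_, h'⟩
            exact zero_ne_one (h.symm.trans h')
          · rw [if_pos ⟨hf, h⟩, h]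
        · rw [if_neg hf, map_zero, if_neg]
          exact fun h => hf h.1
      simp only [h1]
      rw [Finset.sum_boole]
      congr 1
      rw [Fintype.card_subtype]
  apply hm.ne_top
  rw [← top_le_iff, ← D.span_tr_center, Ideal.span_le]
  rintro _ ⟨d, rfl⟩
  rw [SetLike.mem_coe, ← D.residue_center_eq_zero hres]
  change π (β.tr ⊤ d) = 0
  rw [tr, map_sum]
  refine Finset.sum_eq_zero fun b _ => ?_
  by_cases hb : b = e
  · subst hb
    rw [map_sum]
    refine Finset.sum_eq_zero fun a _ => ?_
    rw [map_sum]
    by_cases hemp : IsEmpty (a ⟶ b)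
    · exact Finset.sum_eq_zero fun f _ => hemp.elim f
    · rw [not_isEmpty_iff] at hemp
      obtain ⟨f₀⟩ := hemp
      -- A fixed arrow f₀ identifies the arrows a ⟶ b with loops at b. Following by an element of I
      -- does not change the value on central elements modulo m, so the sum runs over cosets of I.
      let ε : (b ⟶ b) ≃ (a ⟶ b) := ⟨fun γ => f₀ ≫ γ, fun f => Groupoid.inv f₀ ≫ f,
        fun γ => by simp, fun f => by simp⟩
      rw [← Equiv.sum_comp ε]
      refine I.sum_eq_zero_of_right_invariant _ (fun γ j hj => ?_) hI
      rw [if_pos (show ε (γ * j) ∈ (⊤ : Subgroupoid G).arrows a b from trivial),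
        if_pos (show ε γ ∈ (⊤ : Subgroupoid G).arrows a b from trivial)]
      change π (β.act (f₀ ≫ γ ≫ j) d) = π (β.act (f₀ ≫ γ) d)
      rw [← Category.assoc, ← act_act]
      have h1 := congrArg π (D.eps_mul_act j (d := β.act (f₀ ≫ γ) d)
        fun y _ => Subring.mem_center_iff.1 (β.act_center _ d.2) y)
      rw [map_mul, map_mul, hj.2, _root_.one_mul, _root_.one_mul] at h1
      exact h1
  · refine hzero b hb _ (sum_mem fun a _ => sum_mem fun f _ => ?_)
    split_ifs
    · exact β.act_mem _ _
    · exact zero_mem _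

end GaloisCoordinates

end UnitalGroupoidAction

/-! ### The double centralizer property. -/

namespace UnitalGroupoidAction

theorem mem_invariantsMulCenter {K G R : Type*} [CommRing K] [Groupoid G] [Ring R] [Algebra K R]
    (β : UnitalGroupoidAction K G R) {H : Subgroupoid G} {r : R} :
    r ∈ β.invariantsMulCenter H ↔
      r ∈ Submodule.span (Subring.center R) (β.invariants H : Set R) := Iff.rfl

theorem mem_centralizerInvariants_iff {K G R : Type*} [CommRing K] [Groupoid G] [Ring R]
    [Algebra K R] (β : UnitalGroupoidAction K G R) {H : Subgroupoid G} {v : R} :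
    v ∈ β.centralizerInvariants H ↔ ∀ r ∈ β.invariantsMulCenter H, r * v = v * r := by
  refine ⟨fun hv r hr => ?_, fun h s hs => h s (Submodule.subset_span hs)⟩
  rw [mem_invariantsMulCenter] at hr
  induction hr using Submodule.span_induction with
  | mem x hx => exact hv x hx
  | zero => rw [zero_mul, mul_zero]
  | add x y _ _ hx hy => rw [add_mul, mul_add, hx, hy]
  | smul c x _ hx => rw [smul_mul_assoc, mul_smul_comm, hx]

namespace GaloisCoordinates

variable {K G : Type*} {R : Type u} [CommRing K] [Groupoid G] [Fintype G]
  [∀ a b : G, Fintype (a ⟶ b)]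
  [Ring R] [Algebra K R] {β : UnitalGroupoidAction K G R} (D : β.GaloisCoordinates)

section CenterCoordinates

omit [Fintype G] [∀ a b : G, Fintype (a ⟶ b)] in
variable (β) in
/-- The functions `g ↦ ∑ cᵢ β_g(c'ᵢ)` on the arrows with all `cᵢ, c'ᵢ` in the center. -/
def centerFunctions : Submodule (Subring.center R) ((Σ a b : G, a ⟶ b) → R) :=
  Submodule.span _ (Set.range fun (c : Subring.center R) p => β.act p.2.2 (c : R))

omit [Fintype G] [∀ a b : G, Fintype (a ⟶ b)] in
theorem act_mem_centerFunctions {c : R} (hc : c ∈ Subring.center R) :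
    (fun p => β.act p.2.2 c) ∈ centerFunctions β :=
  Submodule.subset_span ⟨⟨c, hc⟩, rfl⟩

omit [Fintype G] [∀ a b : G, Fintype (a ⟶ b)] in
theorem mul_mem_centerFunctions {φ ψ : (Σ a b : G, a ⟶ b) → R} (hφ : φ ∈ centerFunctions β)
    (hψ : ψ ∈ centerFunctions β) : φ * ψ ∈ centerFunctions β := by
  have h := Submodule.mul_mem_mul hφ hψ
  rw [centerFunctions, Submodule.span_mul_span] at h
  refine Submodule.span_mono ?_ h
  rintro _ ⟨_, ⟨c, rfl⟩, _, ⟨d, rfl⟩, rfl⟩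
  exact ⟨c * d, funext fun p => β.act_mul _ _ _⟩

/-- Write 1_e − ε_g = Σ a (c − β_g(c)) and let the arrow vary: f ↦ Σ a (c β_f(1) − β_f(c)) is killed
by ε_f at every loop f, because ε_f β_f(c) = ε_f c. Subtract it from f ↦ β_f(1). -/
theorem exists_centerFunction_loop {e : G} (g : e ⟶ e) :
    ∃ ψ ∈ centerFunctions β, ψ ⟨e, e, g⟩ = D.eps g ∧
      ∀ f : e ⟶ e, D.eps f * ψ ⟨e, e, f⟩ = D.eps f := by
  obtain ⟨κ, hκ, h⟩ := D.one_sub_eps g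
  have key : ∃ χ ∈ centerFunctions β, χ ⟨e, e, g⟩ = κ * β.one e ∧
      ∀ f : e ⟶ e, D.eps f * χ ⟨e, e, f⟩ = 0 := by
    clear h
    induction hκ using Submodule.span_induction with
    | mem x hx =>
      obtain ⟨c, rfl⟩ := hx
      refine ⟨c • (fun p => β.act p.2.2 (1 : R)) - fun p => β.act p.2.2 (c : R),
        sub_mem (Submodule.smul_mem _ _ (act_mem_centerFunctions (Subring.one_mem _)))
          (act_mem_centerFunctions c.2), ?_, fun f => ?_⟩
      · change (c : R) * β.act g 1 - β.act g c = (c - β.act g c) * β.one e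
        rw [act_one, sub_mul, act_mul_one]
      · change D.eps f * ((c : R) * β.act f 1 - β.act f c) = 0
        rw [mul_sub, D.eps_mul_act f fun y _ => Subring.mem_center_iff.1 c.2 y, act_one,
          ← β.one_comm, ← mul_assoc, β.mul_one e (D.eps_mem f), sub_self]
    | zero => exact ⟨0, zero_mem _, (zero_mul _).symm, fun f => mul_zero _⟩
    | add x y _ _ hx hy =>
      obtain ⟨χ, h1, h2, h3⟩ := hx
      obtain ⟨χ', h1', h2', h3'⟩ := hy
      refine ⟨χ + χ', add_mem h1 h1', ?_, fun f => ?_⟩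
      · rw [Pi.add_apply, h2, h2', ← add_mul]
        rfl
      · rw [Pi.add_apply, mul_add, h3, h3', add_zero]
    | smul c x _ hx =>
      obtain ⟨χ, h1, h2, h3⟩ := hx
      refine ⟨c • χ, Submodule.smul_mem _ c h1, ?_, fun f => ?_⟩
      · change (c : R) * χ ⟨e, e, g⟩ = (c * x : R) * β.one e
        rw [h2, mul_assoc]
      · change D.eps f * (c • χ ⟨e, e, f⟩) = 0
        rw [mul_smul_comm, h3, smul_zero]
  obtain ⟨χ, h1, h2, h3⟩ := key
  refine ⟨(fun p => β.act p.2.2 (1 : R)) - χ,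
    sub_mem (act_mem_centerFunctions (Subring.one_mem _)) h1, ?_, fun f => ?_⟩
  · change β.act g 1 - χ ⟨e, e, g⟩ = D.eps g
    rw [act_one, h2, h, sub_mul, one_idem, β.mul_one e (D.eps_mem g), sub_sub_cancel]
  · change D.eps f * (β.act f 1 - χ ⟨e, e, f⟩) = D.eps f
    rw [mul_sub, h3, act_one, β.mul_one e (D.eps_mem f), sub_zero]

/-- Multiply the functions of the single loops: at g ∈ s the factor of g gives ε_g, which absorbs
the others. -/
theorem exists_centerFunction_finset {e : G} (s : Finset (e ⟶ e)) :
    ∃ ψ ∈ centerFunctions β, (∀ g ∈ s, ψ ⟨e, e, g⟩ = D.eps g) ∧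
      ∀ f : e ⟶ e, D.eps f * ψ ⟨e, e, f⟩ = D.eps f := by
  classical
  induction s using Finset.induction_on with
  | empty =>
    refine ⟨fun p => β.act p.2.2 (1 : R), act_mem_centerFunctions (Subring.one_mem _), by simp,
      fun f => ?_⟩
    change D.eps f * β.act f 1 = D.eps f
    rw [act_one, β.mul_one e (D.eps_mem f)]
  | insert g s _ ih =>
    obtain ⟨ψ, h1, h2, h3⟩ := ih
    obtain ⟨χ, h1', h2', h3'⟩ := D.exists_centerFunction_loop g
    refine ⟨χ * ψ, mul_mem_centerFunctions h1' h1, fun f hf => ?_, fun f => ?_⟩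
    · rw [Pi.mul_apply]
      rcases Finset.mem_insert.1 hf with rfl | hf
      · rw [h2', h3]
      · rw [h2 f hf, Subring.mem_center_iff.1 (D.eps_center f), h3']
    · rw [Pi.mul_apply, ← mul_assoc, h3', h3]

theorem exists_centerFunction :
    ∃ ψ ∈ centerFunctions β, (∀ (e : G) (f : e ⟶ e), ψ ⟨e, e, f⟩ = D.eps f) ∧
      ∀ (a b : G) (f : a ⟶ b), a ≠ b → ψ ⟨a, b, f⟩ = 0 := by
  have key : ∀ e : G, ∃ ψ ∈ centerFunctions β, (∀ f : e ⟶ e, ψ ⟨e, e, f⟩ = D.eps f) ∧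
      ∀ (a b : G) (f : a ⟶ b), (a ≠ e ∨ b ≠ e) → ψ ⟨a, b, f⟩ = 0 := by
    intro e
    obtain ⟨ψ, h1, h2, -⟩ := D.exists_centerFunction_finset (Finset.univ : Finset (e ⟶ e))
    refine ⟨((⟨β.one e, β.one_central e⟩ : Subring.center R) • fun p => β.act p.2.2 (β.one e)) * ψ,
      mul_mem_centerFunctions (Submodule.smul_mem _ _
        (act_mem_centerFunctions (β.one_central e))) h1, fun f => ?_, fun a b f hab => ?_⟩
    · change β.one e * β.act f (β.one e) * ψ ⟨e, e, f⟩ = D.eps f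
      rw [h2 f (Finset.mem_univ f), one_mul_act, ← _root_.one_mul (β.one e), act_mul_one_source,
        act_one, β.one_mul e (D.eps_mem f)]
    · change β.one e * β.act f (β.one e) * ψ ⟨a, b, f⟩ = 0
      rcases hab with h | h
      · rw [D.act_ne h.symm f (β.one_mem e), mul_zero, zero_mul]
      · rw [D.mul_ne h.symm (β.one_mem e) (β.act_mem f _), zero_mul]
  choose ψ h1 h2 h3 using key
  refine ⟨∑ e, ψ e, sum_mem fun e _ => h1 e, fun e f => ?_, fun a b f hab => ?_⟩
  · rw [Finset.sum_apply]
    refine (Finset.sum_eq_single e (fun e' _ h => h3 e' e e f (Or.inl h.symm))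
      (fun h => absurd (Finset.mem_univ _) h)).trans (h2 e f)
  · rw [Finset.sum_apply]
    refine Finset.sum_eq_zero fun e _ => h3 e a b f ?_
    by_contra! hcon
    exact hab (hcon.1.trans hcon.2.symm)

end CenterCoordinates

theorem exists_index_inv {H : Subgroupoid G} (hH : H.IsWide) :
    ∃ ν : Subring.center R, (ν : R) * D.index H = 1 := by
  obtain ⟨ν, hν⟩ := (D.isUnit_index hH).exists_left_inv
  exact ⟨ν, congrArg Subtype.val hν⟩

include D in
/-- The double centralizer property of `R^{β_H} C(R)`. -/
theorem mem_invariantsMulCenter_iff {H : Subgroupoid G} (hH : H.IsWide) {d : R} :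
    d ∈ β.invariantsMulCenter H ↔ ∀ v ∈ β.centralizerInvariants H, v * d = d * v := by
  classical
  refine ⟨fun hd v hv => ((β.mem_centralizerInvariants_iff.1 hv) d hd).symm, fun hd => ?_⟩
  obtain ⟨ψ, hψ, h1, h2⟩ := D.exists_centerFunction
  -- For a generator ψ = β(c) this sum is the trace of c d, an invariant; in general it is a
  -- C(R)-combination of such traces.
  have key : ∑ b : G, ∑ a : G, ∑ f : a ⟶ b,
      (if f ∈ H.arrows a b then ψ ⟨a, b, f⟩ * β.act f d else 0) ∈ β.invariantsMulCenter H := by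
    clear h1 h2
    induction hψ using Submodule.span_induction with
    | mem x hx =>
      obtain ⟨c, rfl⟩ := hx
      refine Submodule.subset_span ?_
      have h := D.tr_mem_invariants H (c * d)
      unfold tr at h
      simp only [act_mul] at h
      exact h
    | zero => simp
    | add x y _ _ hx hy =>
      have h := add_mem hx hy
      simp only [← Finset.sum_add_distrib] at h
      convert h using 7
      split_ifs
      · rw [Pi.add_apply, add_mul]
      · rw [add_zero]
    | smul c x _ hx =>
      have h := (β.invariantsMulCenter H).smul_mem hx c
      simp only [Finset.smul_sum, smul_ite, smul_zero] at h
      simpa only [Pi.smul_apply, smul_mul_assoc] using h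
  -- Here ψ is ε_f at loops and 0 elsewhere, and ε_f β_f(d) = ε_f d because d commutes with J_{f⁻¹}.
  have hsum : ∑ b : G, ∑ a : G, ∑ f : a ⟶ b,
      (if f ∈ H.arrows a b then ψ ⟨a, b, f⟩ * β.act f d else 0) = D.index H * d := by
    rw [index, Finset.sum_mul]
    refine Finset.sum_congr rfl fun e _ => ?_
    refine (Finset.sum_eq_single e (fun a _ hae => Finset.sum_eq_zero fun f _ => ?_)
      (fun h => absurd (Finset.mem_univ _) h)).trans ?_
    · rw [h2 a e f hae, zero_mul, ite_self]
    · rw [Finset.sum_mul]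
      refine Finset.sum_congr rfl fun f _ => ?_
      split_ifs with hf
      · rw [h1, D.eps_mul_act f fun y hy => hd y (β.J_mem_centralizer (H.inv hf) hy)]
      · rw [zero_mul]
  rw [hsum] at key
  obtain ⟨ν, hν⟩ := D.exists_index_inv hH
  have h := (β.invariantsMulCenter H).smul_mem key ν
  rw [show ν • (D.index H * d) = (ν : R) * (D.index H * d) from rfl, ← mul_assoc, hν,
    _root_.one_mul] at h
  exact h

/-! ### Separability of the two algebras. -/

section Separable

variable {H : Subgroupoid G}

/-- The tensor `∑ pᵢ ⊗ qᵢ` of the loop idempotent of `f`, in the centralizer of the invariants. -/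
noncomputable def loopTensor {e : G} {f : e ⟶ e} (hf : f ∈ H.arrows e e) :
    β.centralizerInvariants H ⊗[Subring.center R] β.centralizerInvariants H :=
  ∑ i, (⟨D.p f i, β.J_mem_centralizer hf (D.p_mem f i)⟩ : β.centralizerInvariants H) ⊗ₜ
    (⟨D.q f i, β.J_mem_centralizer (H.inv hf) (D.q_mem f i)⟩ : β.centralizerInvariants H)

/-- The central elements q_l y pᵢ are at once the coefficients of y pᵢ in the p_l and of q_l y in
the qᵢ, so they slide across the tensor sign. -/
theorem mul_loopTensor {e : G} {f k : e ⟶ e} (hf : f ∈ H.arrows e e) (hk : k ∈ H.arrows e e)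
    {y : R} (hy : y ∈ β.J k) (hyV : y ∈ β.centralizerInvariants H) :
    ((⟨y, hyV⟩ : β.centralizerInvariants H) ⊗ₜ[Subring.center R]
      (1 : β.centralizerInvariants H)) * D.loopTensor hf =
    D.loopTensor (H.mul hk hf) * ((1 : β.centralizerInvariants H) ⊗ₜ ⟨y, hyV⟩) := by
  simp only [loopTensor, Finset.mul_sum, Finset.sum_mul, Algebra.TensorProduct.tmul_mul_tmul,
    _root_.one_mul, _root_.mul_one]
  let P := fun l => (⟨D.p (k ≫ f) l, β.J_mem_centralizer (H.mul hk hf) (D.p_mem _ l)⟩ :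
    β.centralizerInvariants H)
  let Q := fun i => (⟨D.q f i, β.J_mem_centralizer (H.inv hf) (D.q_mem f i)⟩ :
    β.centralizerInvariants H)
  have hc : ∀ l i, D.q (k ≫ f) l * (y * D.p f i) ∈ Subring.center R := fun l i => by
    refine β.J_id_center (e := e) ?_
    have h := β.J_comp (D.q_mem (k ≫ f) l) (β.J_comp hy (D.p_mem f i))
    rwa [Groupoid.inv_comp] at h
  have h1 : ∀ i, (⟨y, hyV⟩ : β.centralizerInvariants H) *
      ⟨D.p f i, β.J_mem_centralizer hf (D.p_mem f i)⟩ =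
      ∑ l, (⟨_, hc l i⟩ : Subring.center R) • P l := fun i => by
    apply Subtype.ext
    rw [AddSubmonoidClass.coe_finsetSum]
    change y * D.p f i = ∑ l, D.q (k ≫ f) l * (y * D.p f i) * D.p (k ≫ f) l
    conv_lhs => rw [← D.eps_mul_J (β.J_comp hy (D.p_mem f i)), eps, Finset.sum_mul]
    refine Finset.sum_congr rfl fun l _ => ?_
    rw [← Subring.mem_center_iff.1 (hc l i), mul_assoc]
  have h2 : ∀ l, (⟨D.q (k ≫ f) l, β.J_mem_centralizer (H.inv (H.mul hk hf)) (D.q_mem _ l)⟩ :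
      β.centralizerInvariants H) * ⟨y, hyV⟩ =
      ∑ i, (⟨_, hc l i⟩ : Subring.center R) • Q i := fun l => by
    apply Subtype.ext
    rw [AddSubmonoidClass.coe_finsetSum]
    change D.q (k ≫ f) l * y = ∑ i, D.q (k ≫ f) l * (y * D.p f i) * D.q f i
    have h3 : D.q (k ≫ f) l * y ∈ β.J (Groupoid.inv f) := by
      have h := β.J_comp (D.q_mem (k ≫ f) l) hy
      have h4 : Groupoid.inv (k ≫ f) ≫ k = Groupoid.inv f := by simp
      rwa [h4] at h
    conv_lhs => rw [← D.eps_mul_J_inv h3, ← Subring.mem_center_iff.1 (D.eps_center f), eps,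
      Finset.mul_sum]
    exact Finset.sum_congr rfl fun i _ => by simp only [mul_assoc]
  simp only [h1, h2, TensorProduct.sum_tmul, TensorProduct.tmul_sum]
  rw [Finset.sum_comm]
  refine Finset.sum_congr rfl fun l _ => Finset.sum_congr rfl fun i _ => ?_
  exact TensorProduct.smul_tmul _ _ _

theorem mul_loopTensor_ne {e e' : G} (h : e ≠ e') {f : e' ⟶ e'} (hf : f ∈ H.arrows e' e') {y : R}
    (hy : y ∈ β.E e) (hyV : y ∈ β.centralizerInvariants H) :
    ((⟨y, hyV⟩ : β.centralizerInvariants H) ⊗ₜ[Subring.center R]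
      (1 : β.centralizerInvariants H)) * D.loopTensor hf = 0 ∧
    D.loopTensor hf * ((1 : β.centralizerInvariants H) ⊗ₜ ⟨y, hyV⟩) = 0 := by
  simp only [loopTensor, Finset.mul_sum, Finset.sum_mul, Algebra.TensorProduct.tmul_mul_tmul,
    _root_.one_mul, _root_.mul_one]
  constructor
  · refine Finset.sum_eq_zero fun i _ => ?_
    rw [show (⟨y, hyV⟩ : β.centralizerInvariants H) *
      ⟨D.p f i, β.J_mem_centralizer hf (D.p_mem f i)⟩ = 0 from
        Subtype.ext (D.mul_ne h hy (D.p_mem f i).1), TensorProduct.zero_tmul]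
  · refine Finset.sum_eq_zero fun i _ => ?_
    rw [show (⟨D.q f i, β.J_mem_centralizer (H.inv hf) (D.q_mem f i)⟩ :
      β.centralizerInvariants H) * ⟨y, hyV⟩ = 0 from
        Subtype.ext (D.mul_ne h.symm (D.q_mem f i).1 hy), TensorProduct.tmul_zero]

include D in
/-- A property of elements of the centralizer of the invariants that is additive holds if it holds
on the modules `J_k`. -/
theorem centralizer_induction (hH : H.IsWide) {p : R → Prop} (h0 : p 0)
    (hadd : ∀ v w, v ∈ β.centralizerInvariants H → w ∈ β.centralizerInvariants H →
      p v → p w → p (v + w))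
    (hJ : ∀ (e : G) (k : e ⟶ e), k ∈ H.arrows e e → ∀ y ∈ β.J k, p y) {v : R}
    (hv : v ∈ β.centralizerInvariants H) : p v := by
  classical
  let N : AddSubmonoid R :=
    { carrier := {v | v ∈ β.centralizerInvariants H ∧ p v}
      add_mem' := fun ha hb => ⟨add_mem ha.1 hb.1, hadd _ _ ha.1 hb.1 ha.2 hb.2⟩
      zero_mem' := ⟨zero_mem _, h0⟩ }
  have : v ∈ N := by
    rw [D.sum_comp hH hv]
    refine sum_mem fun e _ => sum_mem fun f _ => ?_
    split_ifs with hf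
    · have hJf := D.comp_mem_J hH hf hv
      exact ⟨β.J_mem_centralizer hf hJf, hJ e f hf _ hJf⟩
    · exact zero_mem _
  exact this.2

open Classical in
/-- The sum of the loop tensors of a subgroupoid. -/
noncomputable def sepTensor (H : Subgroupoid G) :
    β.centralizerInvariants H ⊗[Subring.center R] β.centralizerInvariants H :=
  ∑ e : G, ∑ f : e ⟶ e, if hf : f ∈ H.arrows e e then D.loopTensor hf else 0

theorem mul_sepTensor (hH : H.IsWide) (v : β.centralizerInvariants H) :
    (v ⊗ₜ[Subring.center R] (1 : β.centralizerInvariants H)) * D.sepTensor H =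
      D.sepTensor H * ((1 : β.centralizerInvariants H) ⊗ₜ v) := by
  classical
  obtain ⟨v, hv⟩ := v
  have key := D.centralizer_induction hH (p := fun v => ∀ hv : v ∈ β.centralizerInvariants H,
    ((⟨v, hv⟩ : β.centralizerInvariants H) ⊗ₜ[Subring.center R]
      (1 : β.centralizerInvariants H)) * D.sepTensor H =
      D.sepTensor H * ((1 : β.centralizerInvariants H) ⊗ₜ ⟨v, hv⟩)) ?_ ?_ ?_ hv
  · exact key hv
  · intro hv
    rw [show (⟨0, hv⟩ : β.centralizerInvariants H) = 0 from rfl, TensorProduct.zero_tmul,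
      TensorProduct.tmul_zero, zero_mul, mul_zero]
  · intro v w hv hw h1 h2 hvw
    rw [show (⟨v + w, hvw⟩ : β.centralizerInvariants H) = ⟨v, hv⟩ + ⟨w, hw⟩ from rfl,
      TensorProduct.add_tmul, TensorProduct.tmul_add, add_mul, mul_add, h1 hv, h2 hw]
  · intro e k hk y hy hyV
    rw [sepTensor, Finset.mul_sum, Finset.sum_mul]
    refine Finset.sum_congr rfl fun e' _ => ?_
    rw [Finset.mul_sum, Finset.sum_mul]
    by_cases he : e = e'
    · subst he
      let ε : (e ⟶ e) ≃ (e ⟶ e) := ⟨fun f => k ≫ f, fun f => Groupoid.inv k ≫ f,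
        fun f => by simp, fun f => by simp⟩
      refine Fintype.sum_equiv ε _ _ fun f => ?_
      change _ = (if hf : k ≫ f ∈ H.arrows e e then D.loopTensor hf else 0) * _
      by_cases hf : f ∈ H.arrows e e
      · rw [dif_pos hf, dif_pos (H.mul hk hf), D.mul_loopTensor hf hk hy hyV]
      · have hkf : k ≫ f ∉ H.arrows e e := fun h => hf (by
          have := H.mul (H.inv hk) h
          simpa using this)
        rw [dif_neg hf, dif_neg hkf, mul_zero, zero_mul]
    · refine Finset.sum_congr rfl fun f _ => ?_
      split_ifs with hf
      · obtain ⟨h1, h2⟩ := D.mul_loopTensor_ne he hf hy.1 hyV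
        rw [h1, h2]
      · rw [mul_zero, zero_mul]

theorem mul'_sepTensor :
    (LinearMap.mul' (Subring.center R) (β.centralizerInvariants H) (D.sepTensor H) : R) =
      D.index H := by
  classical
  simp only [sepTensor, index, map_sum, AddSubmonoidClass.coe_finsetSum]
  refine Finset.sum_congr rfl fun e _ => Finset.sum_congr rfl fun f _ => ?_
  split_ifs with hf
  · simp only [loopTensor, map_sum, AddSubmonoidClass.coe_finsetSum, LinearMap.mul'_apply]
    rfl
  · rw [map_zero]
    rfl

/-- The form (v, w) ↦ `toCenter` (v w) pairs J_k only with J_{k⁻¹}, and there Σ pᵢqᵢ = ε_k is the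
identity on J_k: the tensor consists of dual bases for this form. -/
theorem lift_sepTensor (hH : H.IsWide) {v : R} (hv : v ∈ β.centralizerInvariants H) :
    TensorProduct.lift (LinearMap.mk₂ (Subring.center R)
      (fun a b : β.centralizerInvariants H => D.toCenter (v * a) • (b : R))
      (fun a a' b => by rw [Subalgebra.coe_add, mul_add, map_add, add_smul])
      (fun c a b => by rw [Subalgebra.coe_smul, mul_smul_comm, map_smul, smul_assoc])
      (fun a b b' => by rw [Subalgebra.coe_add, smul_add])
      (fun c a b => by rw [Subalgebra.coe_smul, smul_comm])) (D.sepTensor H) = v := by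
  classical
  refine D.centralizer_induction hH (p := fun v => TensorProduct.lift
      (LinearMap.mk₂ (Subring.center R)
      (fun a b : β.centralizerInvariants H => D.toCenter (v * a) • (b : R))
      (fun a a' b => by rw [Subalgebra.coe_add, mul_add, map_add, add_smul])
      (fun c a b => by rw [Subalgebra.coe_smul, mul_smul_comm, map_smul, smul_assoc])
      (fun a b b' => by rw [Subalgebra.coe_add, smul_add])
      (fun c a b => by rw [Subalgebra.coe_smul, smul_comm])) (D.sepTensor H) = v) ?_ ?_ ?_ hv
  · simp only [sepTensor, loopTensor, map_sum]
    refine Finset.sum_eq_zero fun e _ => Finset.sum_eq_zero fun f _ => ?_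
    split_ifs
    · simp
    · simp
  · intro v w _ _ hv hw
    conv_rhs => rw [← hv, ← hw]
    rw [← LinearMap.add_apply]
    congr 1
    ext a b
    simp [add_mul, add_smul]
  · intro e k hk y hy
    simp only [sepTensor, map_sum]
    refine (Finset.sum_eq_single e (fun e' _ he' => Finset.sum_eq_zero fun f _ => ?_)
      (fun h => absurd (Finset.mem_univ _) h)).trans ?_
    · split_ifs with hf
      · simp only [loopTensor, map_sum, TensorProduct.lift.tmul, LinearMap.mk₂_apply]
        refine Finset.sum_eq_zero fun i _ => ?_
        rw [D.mul_ne he'.symm hy.1 (D.p_mem f i).1, map_zero, zero_smul]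
      · exact map_zero _
    · refine (Finset.sum_eq_single (Groupoid.inv k) (fun f _ hf' => ?_)
        (fun h => absurd (Finset.mem_univ _) h)).trans ?_
      · split_ifs with hf
        · simp only [loopTensor, map_sum, TensorProduct.lift.tmul, LinearMap.mk₂_apply]
          refine Finset.sum_eq_zero fun i _ => ?_
          have h := D.toCenter_J (β.J_comp hy (D.p_mem f i))
          rw [if_neg (fun h1 => hf' (by
            have := congrArg (Groupoid.inv k ≫ ·) h1
            simpa using this))] at h
          change (D.toCenter (y * D.p f i) : R) * D.q f i = 0
          rw [h, zero_mul]
        · exact map_zero _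
      · rw [dif_pos (H.inv hk)]
        simp only [loopTensor, map_sum, TensorProduct.lift.tmul, LinearMap.mk₂_apply]
        have h1 : ∀ i, D.toCenter (y * D.p (Groupoid.inv k) i) • D.q (Groupoid.inv k) i =
            y * (D.p (Groupoid.inv k) i * D.q (Groupoid.inv k) i) := fun i => by
          have h := D.toCenter_J (β.J_comp hy (D.p_mem (Groupoid.inv k) i))
          rw [if_pos (Groupoid.comp_inv k)] at h
          change (D.toCenter (y * D.p (Groupoid.inv k) i) : R) * _ = _
          rw [h, mul_assoc]
        simp only [h1]
        rw [← Finset.mul_sum, ← eps, D.eps_inv, Subring.mem_center_iff.1 (D.eps_center k),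
          D.eps_mul_J hy]

include D in
theorem isSeparable_centralizerInvariants (hH : H.IsWide) :
    IsSeparableAlgebra (Subring.center R) (β.centralizerInvariants H) := by
  obtain ⟨ν, hν⟩ := D.exists_index_inv hH
  refine ⟨ν • D.sepTensor H, ?_, fun v => ?_⟩
  · rw [map_smul]
    apply Subtype.ext
    rw [Subalgebra.coe_smul, D.mul'_sepTensor]
    exact hν
  · rw [mul_smul_comm, smul_mul_assoc, D.mul_sepTensor hH]

include D in
theorem isSeparable_invariantsMulCenter (hH : H.IsWide) :
    IsSeparableAlgebra (Subring.center R) (β.invariantsMulCenter H) := by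
  obtain ⟨ν, hν⟩ := D.exists_index_inv hH
  obtain ⟨N, a, b, hz⟩ := TensorProduct.exists_sum_tmul_eq (D.sepTensor H)
  have hmul : ∑ k, (a k : R) * b k = D.index H := by
    have h := D.mul'_sepTensor (H := H)
    simpa only [hz, map_sum, LinearMap.mul'_apply, AddSubmonoidClass.coe_finsetSum,
      Subalgebra.coe_mul] using h
  have hcomm : ∀ r, ∀ v ∈ β.centralizerInvariants H,
      ∑ k, v * a k * r * b k = ∑ k, a k * r * b k * v := by
    intro r v hv
    have h := congrArg (TensorProduct.lift (LinearMap.mk₂ (Subring.center R)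
      (fun p q : β.centralizerInvariants H => (p : R) * r * q)
      (fun p p' q => by rw [Subalgebra.coe_add, add_mul, add_mul])
      (fun c p q => by rw [Subalgebra.coe_smul, smul_mul_assoc, smul_mul_assoc])
      (fun p q q' => by rw [Subalgebra.coe_add, mul_add])
      (fun c p q => by rw [Subalgebra.coe_smul, mul_smul_comm]))) (D.mul_sepTensor hH ⟨v, hv⟩)
    simp only [hz, Finset.mul_sum, Finset.sum_mul, Algebra.TensorProduct.tmul_mul_tmul,
      _root_.one_mul, _root_.mul_one, map_sum, TensorProduct.lift.tmul, LinearMap.mk₂_apply,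
      Subalgebra.coe_mul] at h
    simpa only [← mul_assoc] using h
  have hlift : ∀ v ∈ β.centralizerInvariants H,
      ∑ k, (D.toCenter (v * a k) : R) * b k = v := by
    intro v hv
    have h := D.lift_sepTensor hH hv
    simp only [hz, map_sum, TensorProduct.lift.tmul, LinearMap.mk₂_apply] at h
    exact h
  -- The average commutes with the centralizer, so the double centralizer property places it in
  -- R^{β_H}C(R). It is a bimodule map over that algebra, hence carries the family u, v of R to a
  -- commuting tensor.
  let P : R → β.invariantsMulCenter H := fun r => ⟨∑ k, a k * r * b k,
    (D.mem_invariantsMulCenter_iff hH).2 fun v hv => by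
      rw [Finset.mul_sum, Finset.sum_mul, ← hcomm r v hv]
      simp only [mul_assoc]⟩
  have hP : ∀ r, (P r : R) = ∑ k, a k * r * b k := fun r => rfl
  have hPadd : ∀ r s, P (r + s) = P r + P s := fun r s => Subtype.ext (by
    rw [Subalgebra.coe_add]
    simp only [hP, mul_add, add_mul, Finset.sum_add_distrib])
  have hPl : ∀ (d : β.invariantsMulCenter H) r, P (d * r) = d * P r := fun d r => Subtype.ext (by
    rw [Subalgebra.coe_mul, hP, hP, Finset.mul_sum]
    refine Finset.sum_congr rfl fun k _ => ?_
    rw [← mul_assoc, (D.mem_invariantsMulCenter_iff hH).1 d.2 _ (a k).2]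
    simp only [mul_assoc])
  have hPr : ∀ (d : β.invariantsMulCenter H) r, P (r * d) = P r * d := fun d r => Subtype.ext (by
    rw [Subalgebra.coe_mul, hP, hP, Finset.sum_mul]
    refine Finset.sum_congr rfl fun k _ => ?_
    simp only [mul_assoc]
    rw [(D.mem_invariantsMulCenter_iff hH).1 d.2 _ (b k).2])
  have hPc : ∀ (c : Subring.center R) r, P (c * r) = c • P r := fun c r =>
    hPl (algebraMap _ _ c) r
  refine ⟨ν • ∑ j, P (D.u j) ⊗ₜ P (D.v j), ?_, fun d => ?_⟩
  · rw [map_smul, map_sum]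
    apply Subtype.ext
    simp only [Subalgebra.coe_smul, AddSubmonoidClass.coe_finsetSum, LinearMap.mul'_apply,
      Subalgebra.coe_mul, Subalgebra.coe_one, hP]
    -- The sum over j turns the middle factor bₖ aₗ into `toCenter` (bₖ aₗ); the dual basis relation
    -- then collapses the sum over l to bₖ, and Σ aₖbₖ is the index.
    have h1 : ∑ j, (∑ k, (a k : R) * D.u j * b k) * ∑ l, (a l : R) * D.v j * b l =
        ∑ k, a k * ∑ l, (D.toCenter (b k * a l) : R) * b l := by
      simp only [coe_toCenter, Finset.sum_mul, Finset.mul_sum]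
      rw [Finset.sum_comm]
      conv_rhs => rw [Finset.sum_comm]
      refine Finset.sum_congr rfl fun k _ => ?_
      rw [Finset.sum_comm]
      refine Finset.sum_congr rfl fun l _ => Finset.sum_congr rfl fun j _ => ?_
      simp only [mul_assoc]
    rw [h1]
    have h2 : ∀ k, (a k : R) * ∑ l, (D.toCenter (b k * a l) : R) * b l = a k * b k := fun k => by
      rw [hlift _ (b k).2]
    simp only [h2]
    rw [hmul]
    exact hν
  · rw [mul_smul_comm, smul_mul_assoc]
    congr 1
    have h := D.sepFamily.2 (β.invariantsMulCenter H ⊗[Subring.center R] β.invariantsMulCenter H)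
      (fun r s => P r ⊗ₜ P s) (fun r r' s => by rw [hPadd, TensorProduct.add_tmul])
      (fun r s s' => by rw [hPadd, TensorProduct.tmul_add])
      (fun z hz r s => by
        rw [Subring.mem_center_iff.1 hz.1 r, hPc ⟨z, hz.1⟩, hPc ⟨z, hz.1⟩,
          TensorProduct.smul_tmul]) d trivial
    simpa only [Finset.mul_sum, Finset.sum_mul, Algebra.TensorProduct.tmul_mul_tmul,
      _root_.one_mul, _root_.mul_one, hPl, hPr] using h

end Separable

end GaloisCoordinates

/-! ### Classes of wide subgroupoids, and the theorem. -/

theorem S_eq_of_cls_eq {K G R : Type*} [CommRing K] [Groupoid G] [Ring R] [Algebra K R]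
    (β : UnitalGroupoidAction K G R) {H L : Subgroupoid G} (hH : H.IsWide)
    (h : β.cls H = β.cls L) : β.S H = β.S L := by
  -- A class contains only non-empty subgroupoids, so H lies in its own class only if G has an
  -- object; without objects there are no arrows to compare.
  rcases isEmpty_or_nonempty G with hG | ⟨⟨e⟩⟩
  · exact Set.ext fun p => hG.elim p.1
  · have hmem : H ∈ β.cls H := ⟨⟨e, Subgroupoid.mem_objs_of_src H (hH.wide e)⟩, rfl⟩
    rw [h] at hmem
    exact hmem.2

end UnitalGroupoidAction

theorem mainTheorem1 {K G R : Type*} [CommRing K] [Groupoid G] [Finite G] [DecidableEq G]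
    [∀ a b : G, Finite (a ⟶ b)] [Ring R] [Algebra K R]
    (β : UnitalGroupoidAction K G R)
    (hE : DirectSum.IsInternal fun e : G => (β.E e).toSubmodule)
    (hGalois : β.IsGalois)
    (hsep : IsSeparableAlgebra β.centerInvariants β.invariantsOverCenter) :
    ∃ σ γ : β.wideClasses → separableSubalgebras R,
      (∀ (H : Subgroupoid G) (hH : H.IsWide),
        (σ (β.wideCls H hH) : Subalgebra (Subring.center R) R) = β.invariantsMulCenter H) ∧
      (∀ (H : Subgroupoid G) (hH : H.IsWide),
        (γ (β.wideCls H hH) : Subalgebra (Subring.center R) R) =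
          β.centralizerInvariants H) ∧
      Function.Injective σ ∧ Function.Injective γ := by
  have : Fintype G := Fintype.ofFinite G
  have : ∀ a b : G, Fintype (a ⟶ b) := fun a b => Fintype.ofFinite _
  obtain ⟨D⟩ := β.exists_galoisCoordinates hE hGalois hsep
  have hcent : ∀ {H L : Subgroupoid G}, H.IsWide → L.IsWide → β.S H = β.S L →
      β.centralizerInvariants H = β.centralizerInvariants L := fun hH hL h =>
    le_antisymm (D.centralizerInvariants_le hH h) (D.centralizerInvariants_le hL h.symm)
  have hS : ∀ {H L : Subgroupoid G}, H.IsWide → L.IsWide →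
      β.centralizerInvariants H = β.centralizerInvariants L → β.S H = β.S L := fun hH hL h =>
    Set.Subset.antisymm (D.S_subset hL h.le) (D.S_subset hH h.ge)
  have hinv : ∀ {H L : Subgroupoid G}, H.IsWide → L.IsWide →
      β.centralizerInvariants H = β.centralizerInvariants L →
      β.invariantsMulCenter H = β.invariantsMulCenter L := fun hH hL h => by
    ext d
    rw [D.mem_invariantsMulCenter_iff hH, D.mem_invariantsMulCenter_iff hL, h]
  -- Both maps are defined through a chosen wide representative of each class.
  choose W hW hWcls using fun c : β.wideClasses => c.2
  have hWS : ∀ (H : Subgroupoid G) (hH : H.IsWide), β.S (W (β.wideCls H hH)) = β.S H :=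
    fun H hH => (β.S_eq_of_cls_eq hH (hWcls (β.wideCls H hH))).symm
  have hinj : ∀ c c', β.centralizerInvariants (W c) = β.centralizerInvariants (W c') →
      c = c' := fun c c' h => by
    have h1 := hS (hW c) (hW c') h
    apply Subtype.ext
    rw [hWcls c, hWcls c', UnitalGroupoidAction.cls, UnitalGroupoidAction.cls, h1]
  refine ⟨fun c => ⟨β.invariantsMulCenter (W c), D.isSeparable_invariantsMulCenter (hW c)⟩,
    fun c => ⟨β.centralizerInvariants (W c), D.isSeparable_centralizerInvariants (hW c)⟩,
    fun H hH => hinv (hW _) hH (hcent (hW _) hH (hWS H hH)), fun H hH => hcent (hW _) hH (hWS H hH),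
    fun c c' h => hinj c c' ?_, fun c c' h => hinj c c' (congrArg Subtype.val h)⟩
  -- Taking centralizers reduces injectivity of σ to that of γ.
  have h1 : β.invariantsMulCenter (W c) = β.invariantsMulCenter (W c') := congrArg Subtype.val h
  ext v
  rw [β.mem_centralizerInvariants_iff, β.mem_centralizerInvariants_iff, h1]
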